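/- Let $K$ be a field and let $A$ be a finite-dimensional $K$-algebra. Modules are finite-dimensional right $A$-modules unless otherwise stated, and $D=\mathrm{Hom}_K(-,K)$. The dominant dimension of a module $M$ with minimal injective resolution $0\to M\to I_0\to I_1\to\cdots$ is the supremum in $\mathbb{N}\cup\{\infty\}$ of the numbers $n$ such that $I_0,\dots,I_{n-1}$ are projective; the codominant dimension of $M$ is the dominant dimension of the left module $D(M)$. Write $\Omega^{n}(M)$ and $\Omega^{-n}(M)$ for the $n$-th syzygy in a minimal projective resolution and the $n$-th cosyzygy in a minimal injective resolution, and $\mathrm{add}(M)$ for the class of direct summands of finite direct sums of copies of $M$. Write $\mathrm{add}^{+}(M)$ for the class of direct summands of modules $M^n\oplus Q$ with $n\ge 0$ and $Q$ a finite-dimensional projective-injective module. (If $eA$ is the minimal faithful projective-injective right module, then $\mathrm{add}^{+}(M)=\mathrm{add}(M\oplus eA)$.) Assume that $A$ is an Auslander–Gorenstein algebra of Gorenstein dimension $r$: the left and the right regular module both have injective dimension $r$, the right regular module has dominant dimension $r$, and $r\ge 2$. Let $0\le i\le r$ be an integer. 1. Let $X$ be a module of projective dimension $i$ and injective dimension $r-i$.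 Then $X$ has dominant dimension exactly $r-i$ and codominant dimension exactly $i$, and $X$ lies in $\mathrm{add}^{+}(\Omega^{r-i}(D(A)))$ and in $\mathrm{add}^{+}(\Omega^{-i}(A))$. If moreover $X$ has no nonzero projective-injective direct summand, then $X$ lies in $\mathrm{add}(\Omega^{r-i}(D(A)))$ and in $\mathrm{add}(\Omega^{-i}(A))$. 2. $\mathrm{add}^{+}(\Omega^{r-i}(D(A)))=\mathrm{add}^{+}(\Omega^{-i}(A))$. If $0<i<r$, then also $\mathrm{add}(\Omega^{r-i}(D(A)))=\mathrm{add}(\Omega^{-i}(A))$. 3. Conversely, every module in $\mathrm{add}^{+}(\Omega^{r-i}(D(A)))$ that is not projective-injective has projective dimension $i$, injective dimension $r-i$, dominant dimension $r-i$ and codominant dimension $i$. If $0<i<r$, every nonzero module in $\mathrm{add}(\Omega^{r-i}(D(A)))$ has these four dimensions. -/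

import Mathlib

open CategoryTheory

universe u

noncomputable section

namespace AuslanderGorenstein

/-! Modules are left modules over a ring `B`; right modules over `A` are left modules
over `Aᵐᵒᵖ`, and left modules over `A` are modules over `A`. -/

/-- The projective dimension of a module (`⊥` for the zero module). -/
def pdim (B : Type u) [Ring B] (M : Type u) [AddCommGroup M] [Module B M] : WithBot ℕ∞ :=
  projectiveDimension (ModuleCat.of B M)

/-- The injective dimension of a module (`⊥` for the zero module). -/
def idim (B : Type u) [Ring B] (M : Type u) [AddCommGroup M] [Module B M] : WithBot ℕ∞ :=
  injectiveDimension (ModuleCat.of B M)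

/-- `p : P → M` is a projective cover: `P` is projective and `p` is surjective with
superfluous kernel. -/
structure IsProjectiveCover {B P M : Type u} [Ring B] [AddCommGroup P] [Module B P]
    [AddCommGroup M] [Module B M] (p : P →ₗ[B] M) : Prop where
  projective : Module.Projective B P
  surjective : Function.Surjective p
  superfluous : ∀ N : Submodule B P, N ⊔ LinearMap.ker p = ⊤ → N = ⊤

/-- `f : M → I` is an injective hull: `I` is injective and `f` is injective with
essential image. -/
structure IsInjectiveHull {B M I : Type u} [Ring B] [AddCommGroup M] [Module B M]
    [AddCommGroup I] [Module B I] (f : M →ₗ[B] I) : Prop where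
  injective_module : Module.Injective B I
  injective : Function.Injective f
  essential : ∀ N : Submodule B I, N ⊓ LinearMap.range f = ⊥ → N = ⊥

/-- `IsSyzygy B n M S`: the module `S` is (isomorphic to) `Ω^n(M)`, the `n`-th syzygy of `M`
in a minimal projective resolution. -/
def IsSyzygy (B : Type u) [Ring B] : ℕ → (M : Type u) → [AddCommGroup M] → [Module B M] →
    (S : Type u) → [AddCommGroup S] → [Module B S] → Prop
  | 0, M, _, _, S, _, _ => Nonempty (S ≃ₗ[B] M)
  | n + 1, M, _, _, S, _, _ =>
      ∃ (P : Type u) (_ : AddCommGroup P) (_ : Module B P) (p : P →ₗ[B] M),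
        IsProjectiveCover p ∧ IsSyzygy B n (LinearMap.ker p) S

/-- `IsCosyzygy B n M S`: the module `S` is (isomorphic to) `Ω^{-n}(M)`, the `n`-th cosyzygy
of `M` in a minimal injective resolution. -/
def IsCosyzygy (B : Type u) [Ring B] : ℕ → (M : Type u) → [AddCommGroup M] → [Module B M] →
    (S : Type u) → [AddCommGroup S] → [Module B S] → Prop
  | 0, M, _, _, S, _, _ => Nonempty (S ≃ₗ[B] M)
  | n + 1, M, _, _, S, _, _ =>
      ∃ (I : Type u) (_ : AddCommGroup I) (_ : Module B I) (f : M →ₗ[B] I),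
        IsInjectiveHull f ∧ IsCosyzygy B n (I ⧸ LinearMap.range f) S

/-- The first `n` terms `I_0, …, I_{n-1}` of a minimal injective resolution of `M`
are projective. -/
def DomDimGE (B : Type u) [Ring B] : ℕ → (M : Type u) → [AddCommGroup M] → [Module B M] → Prop
  | 0, _, _, _ => True
  | n + 1, M, _, _ =>
      ∃ (I : Type u) (_ : AddCommGroup I) (_ : Module B I) (f : M →ₗ[B] I),
        IsInjectiveHull f ∧ Module.Projective B I ∧ DomDimGE B n (I ⧸ LinearMap.range f)

/-- The dominant dimension of a module: the number of projective terms at the beginning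
of a minimal injective resolution. -/
def domDim (B : Type u) [Ring B] (M : Type u) [AddCommGroup M] [Module B M] : ℕ∞ :=
  ⨆ (n : ℕ) (_ : DomDimGE B n M), (n : ℕ∞)

/-- The `K`-dual `D(M) = Hom_K(M, K)`. -/
def KDual (K M : Type u) [Field K] [AddCommGroup M] [Module K M] : Type u := M →ₗ[K] K

/-- An element of `D(M)` as a linear form. -/
def KDual.toLinearMap {K M : Type u} [Field K] [AddCommGroup M] [Module K M] (f : KDual K M) :
    M →ₗ[K] K := f

section KDual

variable (K A M : Type u) [Field K] [Ring A] [AddCommGroup M] [Module K M]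

instance : AddCommGroup (KDual K M) := inferInstanceAs (AddCommGroup (M →ₗ[K] K))

/-- The dual of a right module is a left module: `(a f)(x) = f(x a)`. -/
instance [Module Aᵐᵒᵖ M] [SMulCommClass Aᵐᵒᵖ K M] : Module A (KDual K M) where
  smul a f := f.toLinearMap.comp
    ({  toFun := fun x => MulOpposite.op a • x
        map_add' := fun x y => smul_add _ x y
        map_smul' := fun c x => smul_comm _ c x } : M →ₗ[K] M)
  one_smul f := LinearMap.ext fun x => congrArg f.toLinearMap (one_smul Aᵐᵒᵖ x)
  mul_smul a b f := LinearMap.ext fun x =>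
    congrArg f.toLinearMap (mul_smul (MulOpposite.op b) (MulOpposite.op a) x)
  smul_zero _ := rfl
  smul_add _ _ _ := rfl
  add_smul a b f := LinearMap.ext fun x =>
    (congrArg f.toLinearMap
      (add_smul (MulOpposite.op a) (MulOpposite.op b) x)).trans
      (map_add f.toLinearMap _ _)
  zero_smul f := LinearMap.ext fun x =>
    (congrArg f.toLinearMap (zero_smul Aᵐᵒᵖ x)).trans
      (map_zero f.toLinearMap)

/-- The dual of a left module is a right module: `(f a)(x) = f(a x)`. -/
instance [Module A M] [SMulCommClass A K M] : Module Aᵐᵒᵖ (KDual K M) where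
  smul a f := f.toLinearMap.comp
    ({  toFun := fun x => a.unop • x
        map_add' := fun x y => smul_add _ x y
        map_smul' := fun c x => smul_comm _ c x } : M →ₗ[K] M)
  one_smul f := LinearMap.ext fun x => congrArg f.toLinearMap (one_smul A x)
  mul_smul a b f := LinearMap.ext fun x =>
    congrArg f.toLinearMap (mul_smul b.unop a.unop x)
  smul_zero _ := rfl
  smul_add _ _ _ := rfl
  add_smul a b f := LinearMap.ext fun x =>
    (congrArg f.toLinearMap (add_smul a.unop b.unop x)).trans
      (map_add f.toLinearMap _ _)
  zero_smul f := LinearMap.ext fun x =>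
    (congrArg f.toLinearMap (zero_smul A x)).trans
      (map_zero f.toLinearMap)

end KDual

/-- The codominant dimension of a right `A`-module `M`: the dominant dimension of the
left `A`-module `D(M)`. -/
def codomDim (K A M : Type u) [Field K] [Ring A] [AddCommGroup M] [Module K M]
    [Module Aᵐᵒᵖ M] [SMulCommClass Aᵐᵒᵖ K M] : ℕ∞ :=
  domDim A (KDual K M)

/-- `A` is an Auslander–Gorenstein algebra of Gorenstein dimension `r`: both regular modules
have injective dimension `r`, the regular right module has dominant dimension `r`,
and `r ≥ 2`. -/
structure IsAuslanderGorenstein (A : Type u) [Ring A] (r : ℕ) : Prop where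
  idim_left : idim A A = (r : ℕ∞)
  idim_right : idim Aᵐᵒᵖ A = (r : ℕ∞)
  domDim_eq : domDim Aᵐᵒᵖ A = r
  two_le : 2 ≤ r

/-- `M` is projective and injective. -/
def IsProjInj (B : Type u) [Ring B] (M : Type u) [AddCommGroup M] [Module B M] : Prop :=
  Module.Projective B M ∧ Module.Injective B M

/-- `M` has no nonzero direct summand that is projective and injective. -/
def NoProjInjSummand (B : Type u) [Ring B] (M : Type u) [AddCommGroup M] [Module B M] : Prop :=
  ∀ N N' : Submodule B M, IsCompl N N' → IsProjInj B N → N = ⊥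

/-- `M ∈ add(S)`: `M` is a direct summand of a finite direct sum of copies of `S`. -/
def InAdd (B : Type u) [Ring B] (S : Type u) [AddCommGroup S] [Module B S]
    (M : Type u) [AddCommGroup M] [Module B M] : Prop :=
  ∃ (n : ℕ) (s : M →ₗ[B] (Fin n → S)) (t : (Fin n → S) →ₗ[B] M), t ∘ₗ s = LinearMap.id

/-- `M ∈ add(S ⊕ eA)`: `M` is a direct summand of `S^n ⊕ Q` with `Q` a finitely generated
projective-injective module. -/
def InAddPI (B : Type u) [Ring B] (S : Type u) [AddCommGroup S] [Module B S]
    (M : Type u) [AddCommGroup M] [Module B M] : Prop :=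
  ∃ (Q : Type u) (_ : AddCommGroup Q) (_ : Module B Q) (n : ℕ)
    (s : M →ₗ[B] ((Fin n → S) × Q)) (t : ((Fin n → S) × Q) →ₗ[B] M),
    Module.Finite B Q ∧ IsProjInj B Q ∧ t ∘ₗ s = LinearMap.id

/-- `M ∈ add(Ω^n(N))`. -/
def InAddSyzygy (B : Type u) [Ring B] (n : ℕ) (N : Type u) [AddCommGroup N] [Module B N]
    (M : Type u) [AddCommGroup M] [Module B M] : Prop :=
  ∃ (S : Type u) (_ : AddCommGroup S) (_ : Module B S), IsSyzygy B n N S ∧ InAdd B S M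

/-- `M ∈ add(Ω^{-n}(N))`. -/
def InAddCosyzygy (B : Type u) [Ring B] (n : ℕ) (N : Type u) [AddCommGroup N] [Module B N]
    (M : Type u) [AddCommGroup M] [Module B M] : Prop :=
  ∃ (S : Type u) (_ : AddCommGroup S) (_ : Module B S), IsCosyzygy B n N S ∧ InAdd B S M

/-- `M ∈ add(Ω^n(N) ⊕ eA)`. -/
def InAddPISyzygy (B : Type u) [Ring B] (n : ℕ) (N : Type u) [AddCommGroup N] [Module B N]
    (M : Type u) [AddCommGroup M] [Module B M] : Prop :=
  ∃ (S : Type u) (_ : AddCommGroup S) (_ : Module B S), IsSyzygy B n N S ∧ InAddPI B S M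

/-- `M ∈ add(Ω^{-n}(N) ⊕ eA)`. -/
def InAddPICosyzygy (B : Type u) [Ring B] (n : ℕ) (N : Type u) [AddCommGroup N] [Module B N]
    (M : Type u) [AddCommGroup M] [Module B M] : Prop :=
  ∃ (S : Type u) (_ : AddCommGroup S) (_ : Module B S), IsCosyzygy B n N S ∧ InAddPI B S M

/-- The right `A`-module `M` has projective dimension `i`, injective dimension `j`, dominant
dimension `j` and codominant dimension `i`. -/
structure HasDims (K A M : Type u) [Field K] [Ring A] [AddCommGroup M] [Module K M]
    [Module Aᵐᵒᵖ M] [SMulCommClass Aᵐᵒᵖ K M] (i j : ℕ) : Prop where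
  pdim_eq : pdim Aᵐᵒᵖ M = (i : ℕ∞)
  idim_eq : idim Aᵐᵒᵖ M = (j : ℕ∞)
  domDim_eq : domDim Aᵐᵒᵖ M = j
  codomDim_eq : codomDim K A M = i

end AuslanderGorenstein

end

/-! Everything is done modulo finitely generated projective-injective summands (`StableRetract`).
Call an exact sequence 0 → M → Q₀ → ⋯ → Qₙ₋₁ → S → 0 with all Qⱼ finitely generated
projective-injective a chain from M to S. Since the Qⱼ are injective, cokernels are functorial
modulo such summands; since they are projective, so are kernels. Hence, for two chains of equal
length, the left ends are related by `StableRetract` exactly when the right ends are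
(`Chain.stableRetract`).

The hypotheses on the right regular module give a chain of length r from A to an injective module I.
The left regular module has finite injective dimension, so D(A) has finite projective dimension;
coresolving along a projective resolution puts D(A) in add⁺(I), while I, being injective, lies in
add(D(A)). It follows that all finitely generated injectives have codominant dimension at least r
(`IsAuslanderGorenstein.coGE`), and cutting the chain at place i identifies add⁺(Ω^{-i}(A)) with
add⁺(Ω^{r-i}(D(A))) (`IsAuslanderGorenstein.stableRetract_syzygy`).

If X has projective dimension at most i, induction on syzygies gives it dominant dimension at least
r - i; dually for injective and codominant dimension. So X starts a chain of length r - i. If its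
injective dimension is at most r - i, the chain ends in an injective module, a member of add(D(A)),
and transport back along the chain puts X in add⁺(Ω^{r-i}(D(A))). Conversely, the chains ending in
D(A) and starting in A bound the injective and projective dimension of such modules. The bounds are
sharp off the projective-injectives, because a coresolution by projective-injectives longer than the
injective dimension splits.

To pass from add⁺ to add, Fitting's lemma discards the projective-injective summand when X has none.
For 0 < i < r, minimality of the resolutions shows that add(Ω^{r-i}(D(A))) has no nonzero injective
member and add(Ω^{-i}(A)) no nonzero projective one. -/

namespace AuslanderGorenstein

/-! ### Short exact sequences and retracts modulo projective-injective summands. -/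

section Basic

variable {B : Type u} [Ring B]

/-- A finitely generated projective-injective module. -/
def FPI (B : Type u) [Ring B] (M : Type u) [AddCommGroup M] [Module B M] : Prop :=
  Module.Finite B M ∧ IsProjInj B M

/-- A short exact sequence `0 → M → Q → C → 0`. -/
structure IsSES {M Q C : Type u} [AddCommGroup M] [Module B M] [AddCommGroup Q] [Module B Q]
    [AddCommGroup C] [Module B C] (f : M →ₗ[B] Q) (g : Q →ₗ[B] C) : Prop where
  inj : Function.Injective f
  surj : Function.Surjective g
  exact : Function.Exact f g

variable {M N P Q C : Type u} [AddCommGroup M] [Module B M] [AddCommGroup N] [Module B N]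
  [AddCommGroup P] [Module B P] [AddCommGroup Q] [Module B Q] [AddCommGroup C] [Module B C]

theorem isSES_mkQ {f : M →ₗ[B] Q} (hf : Function.Injective f) :
    IsSES f (LinearMap.range f).mkQ :=
  ⟨hf, Submodule.mkQ_surjective _, fun x => by simp⟩

theorem isSES_ker {g : Q →ₗ[B] C} (hg : Function.Surjective g) :
    IsSES (LinearMap.ker g).subtype g :=
  ⟨Submodule.subtype_injective _, hg, fun x => by simp⟩

/-- The third term of a short exact sequence is the cokernel. -/
noncomputable def IsSES.quotEquiv {f : M →ₗ[B] Q} {g : Q →ₗ[B] C} (h : IsSES f g) :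
    (Q ⧸ LinearMap.range f) ≃ₗ[B] C :=
  (Submodule.quotEquivOfEq _ _ (LinearMap.exact_iff.1 h.exact).symm).trans
    (g.quotKerEquivOfSurjective h.surj)

/-- The first term of a short exact sequence is the kernel. -/
noncomputable def IsSES.kerEquiv {f : M →ₗ[B] Q} {g : Q →ₗ[B] C} (h : IsSES f g) :
    M ≃ₗ[B] LinearMap.ker g :=
  (LinearEquiv.ofInjective f h.inj).trans
    (LinearEquiv.ofEq _ _ (LinearMap.exact_iff.1 h.exact).symm)

theorem IsSES.pi {f : M →ₗ[B] Q} {g : Q →ₗ[B] C} (h : IsSES f g) (n : ℕ) :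
    IsSES (f.compLeft (Fin n)) (g.compLeft (Fin n)) := by
  refine ⟨h.inj.comp_left, h.surj.comp_left, fun x => ?_⟩
  constructor
  · intro hx
    choose y hy using fun i => (h.exact (x i)).1 (congrFun hx i)
    exact ⟨y, funext hy⟩
  · rintro ⟨y, rfl⟩
    exact funext fun i => h.exact.apply_apply_eq_zero (y i)

/-- A short exact sequence of modules as a short exact sequence in the category of modules. -/
theorem IsSES.shortExact {f : M →ₗ[B] Q} {g : Q →ₗ[B] C} (h : IsSES f g) :
    (ShortComplex.mk (ModuleCat.ofHom f) (ModuleCat.ofHom g)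
      (by ext x; exact h.exact.apply_apply_eq_zero x)).ShortExact where
  exact := (ShortComplex.ShortExact.moduleCat_exact_iff_function_exact _).2 h.exact
  mono_f := (ModuleCat.mono_iff_injective _).2 h.inj
  epi_g := (ModuleCat.epi_iff_surjective _).2 h.surj

theorem _root_.Module.Injective.of_retract [hQ : Module.Injective B Q] (s : M →ₗ[B] Q)
    (t : Q →ₗ[B] M) (h : t ∘ₗ s = LinearMap.id) : Module.Injective B M where
  out X Y _ _ _ _ f hf g := by
    obtain ⟨k, hk⟩ := hQ.out f hf (s ∘ₗ g)
    exact ⟨t ∘ₗ k, fun x => by simpa [hk] using LinearMap.congr_fun h (g x)⟩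

theorem _root_.Module.Injective.extend [hQ : Module.Injective B Q] {f : M →ₗ[B] N}
    (hf : Function.Injective f) (g : M →ₗ[B] Q) : ∃ k : N →ₗ[B] Q, k ∘ₗ f = g := by
  obtain ⟨k, hk⟩ := hQ.out f hf g
  exact ⟨k, LinearMap.ext hk⟩

instance _root_.Module.Injective.instProd [hM : Module.Injective B M] [hN : Module.Injective B N] :
    Module.Injective B (M × N) where
  out X Y _ _ _ _ f hf g := by
    obtain ⟨k, hk⟩ := hM.out f hf (LinearMap.fst B M N ∘ₗ g)
    obtain ⟨l, hl⟩ := hN.out f hf (LinearMap.snd B M N ∘ₗ g)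
    exact ⟨k.prod l, fun x => Prod.ext (hk x) (hl x)⟩

theorem _root_.Module.Injective.finPi [hM : Module.Injective B M] (n : ℕ) :
    Module.Injective B (Fin n → M) where
  out X Y _ _ _ _ f hf g := by
    choose k hk using fun i => hM.out f hf (LinearMap.proj i ∘ₗ g)
    exact ⟨LinearMap.pi k, fun x => funext fun i => hk i x⟩

theorem _root_.Module.Projective.finPi [Module.Projective B M] (n : ℕ) :
    Module.Projective B (Fin n → M) :=
  have : Module.Projective B (Π₀ _ : Fin n, M) := inferInstance
  Module.Projective.of_equiv (DFinsupp.linearEquivFunOnFintype (R := B) (M := fun _ : Fin n => M))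

theorem FPI.of_retract (hQ : FPI B Q) (s : M →ₗ[B] Q)
    (t : Q →ₗ[B] M) (h : t ∘ₗ s = LinearMap.id) : FPI B M := by
  have := hQ.1
  have := hQ.2.1
  have := hQ.2.2
  exact ⟨Module.Finite.of_surjective t fun x => ⟨s x, LinearMap.congr_fun h x⟩,
    Module.Projective.of_split s t h, .of_retract s t h⟩

theorem FPI.prod (hM : FPI B M) (hN : FPI B N) : FPI B (M × N) := by
  obtain ⟨h1, h2, h3⟩ := hM
  obtain ⟨k1, k2, k3⟩ := hN
  exact ⟨inferInstance, inferInstance, inferInstance⟩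

theorem FPI.pi (hM : FPI B M) (n : ℕ) : FPI B (Fin n → M) := by
  obtain ⟨h1, h2, h3⟩ := hM
  exact ⟨inferInstance, .finPi n, .finPi n⟩

theorem IsProjInj.of_subsingleton [Subsingleton M] : IsProjInj B M :=
  ⟨inferInstance, ⟨fun _ _ _ _ _ _ _ _ _ => ⟨0, fun _ => Subsingleton.elim _ _⟩⟩⟩

theorem FPI.of_subsingleton [Subsingleton M] : FPI B M :=
  ⟨inferInstance, .of_subsingleton⟩

theorem IsSES.split_of_injective {f : M →ₗ[B] Q} {g : Q →ₗ[B] C} (h : IsSES f g)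
    (hM : Module.Injective B M) :
    (∃ t : Q →ₗ[B] M, t ∘ₗ f = LinearMap.id) ∧ ∃ s : C →ₗ[B] Q, g ∘ₗ s = LinearMap.id := by
  have ht := Module.Injective.extend h.inj (LinearMap.id : M →ₗ[B] M)
  have hts := (h.exact.split_tfae' (f := f) (g := g)).out 0 1
  exact ⟨ht, (hts.2 ⟨h.surj, ht⟩).2⟩

theorem IsSES.split_of_projective {f : M →ₗ[B] Q} {g : Q →ₗ[B] C} (h : IsSES f g)
    (hC : Module.Projective B C) :
    (∃ t : Q →ₗ[B] M, t ∘ₗ f = LinearMap.id) ∧ ∃ s : C →ₗ[B] Q, g ∘ₗ s = LinearMap.id := by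
  have hs := Module.projective_lifting_property g LinearMap.id h.surj
  have hts := (h.exact.split_tfae' (f := f) (g := g)).out 0 1
  exact ⟨(hts.1 ⟨h.inj, hs⟩).2, hs⟩

/-- `M` is a retract of `N ⊕ Q` with `Q` finitely generated projective-injective. -/
def StableRetract (B : Type u) [Ring B] (M N : Type u) [AddCommGroup M] [Module B M]
    [AddCommGroup N] [Module B N] : Prop :=
  ∃ (Q : ModuleCat.{u} B) (s : M →ₗ[B] N × Q) (t : N × Q →ₗ[B] M),
    FPI B Q ∧ t ∘ₗ s = LinearMap.id

theorem inAddPI_iff : InAddPI B N M ↔ ∃ n : ℕ, StableRetract B M (Fin n → N) := by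
  constructor
  · rintro ⟨Q, _, _, n, s, t, h1, h2, h3⟩
    exact ⟨n, ModuleCat.of B Q, s, t, ⟨h1, h2⟩, h3⟩
  · rintro ⟨n, Q, s, t, h1, h3⟩
    exact ⟨Q, _, _, n, s, t, h1.1, h1.2, h3⟩

theorem StableRetract.of_retract (s : M →ₗ[B] N) (t : N →ₗ[B] M)
    (h : t ∘ₗ s = LinearMap.id) : StableRetract B M N :=
  ⟨ModuleCat.of B PUnit, s.prod 0, t ∘ₗ LinearMap.fst _ _ _, .of_subsingleton,
    LinearMap.ext fun x => LinearMap.congr_fun h x⟩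

theorem StableRetract.of_equiv (e : M ≃ₗ[B] N) : StableRetract B M N :=
  .of_retract e.toLinearMap e.symm.toLinearMap (by ext; simp)

theorem StableRetract.refl : StableRetract B M M := .of_equiv (.refl B M)

theorem StableRetract.trans (h : StableRetract B M N) (h' : StableRetract B N P) :
    StableRetract B M P := by
  obtain ⟨Q, s, t, hQ, hst⟩ := h
  obtain ⟨Q', s', t', hQ', hst'⟩ := h'
  refine ⟨ModuleCat.of B (Q' × Q),
    (LinearEquiv.prodAssoc B P Q' Q).toLinearMap ∘ₗ s'.prodMap LinearMap.id ∘ₗ s,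
    t ∘ₗ t'.prodMap LinearMap.id ∘ₗ (LinearEquiv.prodAssoc B P Q' Q).symm.toLinearMap,
    hQ'.prod hQ, ?_⟩
  ext x
  have h1 : ∀ y, t' (s' y) = y := LinearMap.congr_fun hst'
  have h2 : ∀ y, t (s y) = y := LinearMap.congr_fun hst
  change t (t' (s' (s x).1), (s x).2) = x
  rw [h1]
  exact h2 x

theorem StableRetract.pi (h : StableRetract B M N) (n : ℕ) :
    StableRetract B (Fin n → M) (Fin n → N) := by
  obtain ⟨Q, s, t, hQ, hst⟩ := h
  have h2 : ∀ y, t (s y) = y := LinearMap.congr_fun hst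
  refine ⟨ModuleCat.of B (Fin n → Q),
    ((LinearMap.fst B N Q ∘ₗ s).compLeft (Fin n)).prod
      ((LinearMap.snd B N Q ∘ₗ s).compLeft (Fin n)),
    LinearMap.pi fun i => t ∘ₗ
      ((LinearMap.proj i : (Fin n → N) →ₗ[B] N).prodMap (LinearMap.proj i : (Fin n → Q) →ₗ[B] Q)),
      hQ.pi n, ?_⟩
  refine LinearMap.ext fun x => funext fun i => ?_
  exact h2 (x i)

/-- Transitivity of membership in add⁺: a power of a power is again a power. -/
theorem StableRetract.trans_pi {m n : ℕ} (h : StableRetract B M (Fin m → N))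
    (h' : StableRetract B N (Fin n → P)) : StableRetract B M (Fin (m * n) → P) :=
  (h.trans (h'.pi m)).trans (.of_equiv
    ((LinearEquiv.curry B P (Fin m) (Fin n)).symm.trans
      (LinearEquiv.funCongrLeft B P finProdFinEquiv.symm)))

theorem StableRetract.finite (h : StableRetract B M N) [Module.Finite B N] :
    Module.Finite B M := by
  obtain ⟨Q, s, t, hQ, hst⟩ := h
  have := hQ.1
  exact Module.Finite.of_surjective t fun x => ⟨s x, LinearMap.congr_fun hst x⟩

end Basic
end AuslanderGorenstein

namespace AuslanderGorenstein

/-! ### Chains of projective-injective modules and stable functoriality of syzygies. -/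

section Chains

variable {B : Type u} [Ring B]

section
variable {M N P Q C M' Q' C' : Type u} [AddCommGroup M] [Module B M] [AddCommGroup N] [Module B N]
  [AddCommGroup P] [Module B P] [AddCommGroup Q] [Module B Q] [AddCommGroup C] [Module B C]
  [AddCommGroup M'] [Module B M'] [AddCommGroup Q'] [Module B Q'] [AddCommGroup C'] [Module B C']

theorem IsSES.desc {f : M →ₗ[B] Q} {g : Q →ₗ[B] C} (h : IsSES f g) (k : Q →ₗ[B] N)
    (hk : ∀ x, k (f x) = 0) : ∃ l : C →ₗ[B] N, ∀ x, l (g x) = k x := by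
  have hle : LinearMap.range f ≤ LinearMap.ker k := by
    rintro _ ⟨x, rfl⟩
    exact hk x
  refine ⟨(LinearMap.range f).liftQ k hle ∘ₗ h.quotEquiv.symm.toLinearMap, fun x => ?_⟩
  have : h.quotEquiv.symm (g x) = (LinearMap.range f).mkQ x := by
    rw [LinearEquiv.symm_apply_eq]
    rfl
  simp [this]

theorem IsSES.lift {f : M →ₗ[B] Q} {g : Q →ₗ[B] C} (h : IsSES f g) (k : N →ₗ[B] Q)
    (hk : ∀ x, g (k x) = 0) : ∃ l : N →ₗ[B] M, ∀ x, f (l x) = k x := by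
  refine ⟨h.kerEquiv.symm.toLinearMap ∘ₗ k.codRestrict (LinearMap.ker g) hk, fun x => ?_⟩
  have : h.kerEquiv (h.kerEquiv.symm (k.codRestrict (LinearMap.ker g) hk x)) = _ :=
    LinearEquiv.apply_symm_apply _ _
  exact congrArg Subtype.val this

/-- Cosyzygies are functorial up to projective-injective summands. -/
theorem StableRetract.cokernel {f : M →ₗ[B] Q} {g : Q →ₗ[B] C} (h : IsSES f g) (hQ : FPI B Q)
    {f' : M' →ₗ[B] Q'} {g' : Q' →ₗ[B] C'} (h' : IsSES f' g') (hQ' : Module.Injective B Q')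
    (hM : StableRetract B M M') : StableRetract B C C' := by
  obtain ⟨Q₀, s, t, hQ₀, hst⟩ := hM
  have := hQ.2.2
  have := hQ₀.2.2
  have hinj : Function.Injective (f'.prodMap (LinearMap.id : Q₀ →ₗ[B] Q₀)) := by
    rintro ⟨a, b⟩ ⟨c, d⟩ hab
    have h2 : b = d := congrArg Prod.snd hab
    exact Prod.ext (h'.inj (congrArg Prod.fst hab)) h2
  obtain ⟨σ, hσ⟩ := Module.Injective.extend h.inj (f'.prodMap (LinearMap.id : Q₀ →ₗ[B] Q₀) ∘ₗ s)
  obtain ⟨τ, hτ⟩ := Module.Injective.extend hinj (f ∘ₗ t)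
  replace hσ : ∀ x, σ (f x) = (f' (s x).1, (s x).2) := LinearMap.congr_fun hσ
  replace hτ : ∀ y q, τ (f' y, q) = f (t (y, q)) := fun y q => LinearMap.congr_fun hτ (y, q)
  replace hst : ∀ x, t (s x) = x := LinearMap.congr_fun hst
  obtain ⟨s', hs'⟩ := h.desc (g' ∘ₗ LinearMap.fst B Q' Q₀ ∘ₗ σ) fun x => by
    simp [hσ, h'.exact.apply_apply_eq_zero]
  obtain ⟨t', ht'⟩ := h'.desc (g ∘ₗ τ ∘ₗ LinearMap.inl B Q' Q₀) fun y => by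
    simp [hτ, h.exact.apply_apply_eq_zero]
  -- `τ ∘ σ` need not be the identity of `Q`, but the two agree on `M`. The difference therefore
  -- factors through `C`, and this correction `C → Q` is what costs the extra summand `Q`.
  obtain ⟨ρ, hρ⟩ := h.desc (LinearMap.id - τ ∘ₗ σ) fun x => by
    simp [hσ, hτ, hst]
  refine ⟨ModuleCat.of B Q, s'.prod ρ, t'.coprod g, hQ, LinearMap.ext fun c => ?_⟩
  obtain ⟨q, rfl⟩ := h.surj c
  have h1 : τ (σ q) = τ ((σ q).1, 0) + τ (0, (σ q).2) := by simp [← map_add]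
  have h2 : g (τ (0, (σ q).2)) = 0 := by
    have := hτ 0 (σ q).2
    rw [map_zero] at this
    rw [this, h.exact.apply_apply_eq_zero]
  have h3 : t' (s' (g q)) = g (τ (σ q)) := by
    rw [hs', h1, map_add, h2, add_zero]
    exact ht' _
  change t' (s' (g q)) + g (ρ (g q)) = g q
  rw [h3, hρ]
  simp

/-- Syzygies are functorial up to projective-injective summands. -/
theorem StableRetract.kernel {f : M →ₗ[B] Q} {g : Q →ₗ[B] C} (h : IsSES f g) (hQ : FPI B Q)
    {f' : M' →ₗ[B] Q'} {g' : Q' →ₗ[B] C'} (h' : IsSES f' g') (hQ' : Module.Projective B Q')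
    (hC : StableRetract B C C') : StableRetract B M M' := by
  obtain ⟨Q₀, s, t, hQ₀, hst⟩ := hC
  have := hQ.2.1
  have := hQ₀.2.1
  have hsurj : Function.Surjective (g'.prodMap (LinearMap.id : Q₀ →ₗ[B] Q₀)) := by
    rintro ⟨a, b⟩
    obtain ⟨q, rfl⟩ := h'.surj a
    exact ⟨(q, b), rfl⟩
  obtain ⟨σ, hσ⟩ := Module.projective_lifting_property
    (g'.prodMap (LinearMap.id : Q₀ →ₗ[B] Q₀)) (s ∘ₗ g) hsurj
  obtain ⟨τ, hτ⟩ := Module.projective_lifting_property g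
    (t ∘ₗ g'.prodMap (LinearMap.id : Q₀ →ₗ[B] Q₀)) h.surj
  replace hσ : ∀ x, (g' (σ x).1, (σ x).2) = s (g x) := LinearMap.congr_fun hσ
  replace hτ : ∀ y q, g (τ (y, q)) = t (g' y, q) := fun y q => LinearMap.congr_fun hτ (y, q)
  replace hst : ∀ x, t (s x) = x := LinearMap.congr_fun hst
  have hσ0 : ∀ x, g' (σ (f x)).1 = 0 ∧ (σ (f x)).2 = 0 := fun x => by
    have := hσ (f x)
    rw [h.exact.apply_apply_eq_zero, map_zero] at this
    exact ⟨congrArg Prod.fst this, congrArg Prod.snd this⟩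
  obtain ⟨s', hs'⟩ := h'.lift (LinearMap.fst B Q' Q₀ ∘ₗ σ ∘ₗ f) fun x => (hσ0 x).1
  obtain ⟨t', ht'⟩ := h.lift (τ ∘ₗ LinearMap.inl B Q' Q₀ ∘ₗ f') fun y => by
    simp only [LinearMap.comp_apply, LinearMap.inl_apply, hτ, h'.exact.apply_apply_eq_zero]
    exact map_zero t
  -- Dual correction: `id - τ ∘ σ` takes values in the kernel `M`, so the defect of the retraction
  -- passes through the extra summand `Q`.
  obtain ⟨ρ, hρ⟩ := h.lift (LinearMap.id - τ ∘ₗ σ) fun x => by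
    have : g (τ (σ x)) = g x := by
      rw [← Prod.mk.eta (p := σ x), hτ, hσ, hst]
    simp [this]
  refine ⟨ModuleCat.of B Q, s'.prod f, t'.coprod ρ, hQ, LinearMap.ext fun x => h.inj ?_⟩
  change f (t' (s' x) + ρ (f x)) = f x
  have h1 : f (t' (s' x)) = τ (σ (f x)) := by
    rw [ht', ← Prod.mk.eta (p := σ (f x)), (hσ0 x).2]
    simp [hs']
  rw [map_add, h1, hρ]
  simp

end

/-- `S` is obtained from `M` as the last cokernel of `n` successive embeddings into finitely
generated projective-injective modules. -/
def Chain (B : Type u) [Ring B] : ℕ → (M : Type u) → [AddCommGroup M] → [Module B M] →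
    (S : Type u) → [AddCommGroup S] → [Module B S] → Prop
  | 0, M, _, _, S, _, _ => Nonempty (M ≃ₗ[B] S)
  | n + 1, M, _, _, S, _, _ => ∃ (Q C : ModuleCat.{u} B) (f : M →ₗ[B] Q) (g : Q →ₗ[B] C),
      IsSES f g ∧ FPI B Q ∧ Chain B n C S

/-- `M` is obtained from `S` as the last kernel of `n` successive surjections from finitely
generated projective-injective modules. -/
def CoChain (B : Type u) [Ring B] : ℕ → (M : Type u) → [AddCommGroup M] → [Module B M] →
    (S : Type u) → [AddCommGroup S] → [Module B S] → Prop
  | 0, M, _, _, S, _, _ => Nonempty (M ≃ₗ[B] S)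
  | n + 1, M, _, _, S, _, _ => ∃ (K Q : ModuleCat.{u} B) (f : K →ₗ[B] Q) (g : Q →ₗ[B] S),
      IsSES f g ∧ FPI B Q ∧ CoChain B n M K

variable {M N P Q C M' Q' C' S S' : Type u} [AddCommGroup M] [Module B M] [AddCommGroup N]
  [Module B N] [AddCommGroup P] [Module B P] [AddCommGroup Q] [Module B Q] [AddCommGroup C]
  [Module B C] [AddCommGroup M'] [Module B M'] [AddCommGroup Q'] [Module B Q'] [AddCommGroup C']
  [Module B C'] [AddCommGroup S] [Module B S] [AddCommGroup S'] [Module B S']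

theorem IsSES.congr_left {f : M →ₗ[B] Q} {g : Q →ₗ[B] C} (h : IsSES f g) (e : M' ≃ₗ[B] M) :
    IsSES (f ∘ₗ e.toLinearMap) g :=
  ⟨h.inj.comp e.injective, h.surj, fun x => (h.exact x).trans
    ⟨fun ⟨y, hy⟩ => ⟨e.symm y, by simp [hy]⟩, fun ⟨y, hy⟩ => ⟨e y, hy⟩⟩⟩

theorem IsSES.congr_right {f : M →ₗ[B] Q} {g : Q →ₗ[B] C} (h : IsSES f g) (e : C ≃ₗ[B] C') :
    IsSES f (e.toLinearMap ∘ₗ g) :=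
  ⟨h.inj, e.surjective.comp h.surj, fun x => by simpa using h.exact x⟩

theorem Chain.congr_left {n : ℕ} (e : M' ≃ₗ[B] M) (h : Chain B n M S) : Chain B n M' S := by
  cases n with
  | zero => exact h.elim fun k => ⟨e.trans k⟩
  | succ n =>
    obtain ⟨Q, C, f, g, h1, h2, h3⟩ := h
    exact ⟨Q, C, _, g, h1.congr_left e, h2, h3⟩

theorem CoChain.congr_right {n : ℕ} (e : S ≃ₗ[B] S') (h : CoChain B n M S) :
    CoChain B n M S' := by
  cases n with
  | zero => exact h.elim fun k => ⟨k.trans e⟩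
  | succ n =>
    obtain ⟨Q, C, f, g, h1, h2, h3⟩ := h
    exact ⟨Q, C, f, _, h1.congr_right e, h2, h3⟩

/-- A `Chain` is peeled off at its left end and a `CoChain` at its right end. Gluing a piece at the
other end, here and in `CoChain.cons`, shows that both describe the same exact sequences. -/
theorem Chain.snoc {n : ℕ} {f : C →ₗ[B] Q} {g : Q →ₗ[B] S} (h : IsSES f g) (hQ : FPI B Q) :
    ∀ {M : Type u} [AddCommGroup M] [Module B M], Chain B n M C → Chain B (n + 1) M S := by
  induction n with
  | zero =>
    rintro M _ _ ⟨e⟩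
    exact ⟨ModuleCat.of B Q, ModuleCat.of B S, _, g, h.congr_left e, hQ, ⟨.refl B S⟩⟩
  | succ n ih =>
    rintro M _ _ ⟨Q', C', f', g', h1, h2, h3⟩
    exact ⟨Q', C', f', g', h1, h2, ih h3⟩

theorem CoChain.cons {n : ℕ} {f : M →ₗ[B] Q} {g : Q →ₗ[B] C} (h : IsSES f g) (hQ : FPI B Q) :
    ∀ {S : Type u} [AddCommGroup S] [Module B S], CoChain B n C S → CoChain B (n + 1) M S := by
  induction n with
  | zero =>
    rintro S _ _ ⟨e⟩
    exact ⟨ModuleCat.of B M, ModuleCat.of B Q, f, _, h.congr_right e, hQ, ⟨.refl B M⟩⟩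
  | succ n ih =>
    rintro M _ _ ⟨Q', C', f', g', h1, h2, h3⟩
    exact ⟨Q', C', f', g', h1, h2, ih h3⟩

theorem CoChain.chain {n : ℕ} : ∀ {S : Type u} [AddCommGroup S] [Module B S],
    CoChain B n M S → Chain B n M S := by
  induction n with
  | zero => exact fun h => h
  | succ n ih =>
    rintro S _ _ ⟨K, Q, f, g, h1, h2, h3⟩
    exact (ih h3).snoc h1 h2

theorem Chain.coChain {n : ℕ} : ∀ {M : Type u} [AddCommGroup M] [Module B M],
    Chain B n M S → CoChain B n M S := by
  induction n with
  | zero => exact fun h => h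
  | succ n ih =>
    rintro S _ _ ⟨K, Q, f, g, h1, h2, h3⟩
    exact (ih h3).cons h1 h2

theorem Chain.pi {n : ℕ} (m : ℕ) : ∀ {M : Type u} [AddCommGroup M] [Module B M],
    Chain B n M S → Chain B n (Fin m → M) (Fin m → S) := by
  induction n with
  | zero => exact fun ⟨e⟩ => ⟨LinearEquiv.piCongrRight fun _ => e⟩
  | succ n ih =>
    rintro M _ _ ⟨Q, C, f, g, h1, h2, h3⟩
    exact ⟨ModuleCat.of B (Fin m → Q), ModuleCat.of B (Fin m → C), _, _, h1.pi m, h2.pi m, ih h3⟩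

/-- The middle terms are both injective and projective, so `StableRetract.cokernel` pushes a stable
retraction along each step and `StableRetract.kernel` pulls it back. Questions about syzygies of
D(A) thereby become questions about injective modules. -/
theorem Chain.stableRetract {n : ℕ} : ∀ {M M' : Type u} [AddCommGroup M] [Module B M]
    [AddCommGroup M'] [Module B M'], Chain B n M S → Chain B n M' S' →
    (StableRetract B M M' ↔ StableRetract B S S') := by
  induction n with
  | zero =>
    rintro M M' _ _ _ _ ⟨e⟩ ⟨e'⟩
    exact ⟨fun h => (StableRetract.of_equiv e.symm).trans (h.trans (.of_equiv e')),
      fun h => (StableRetract.of_equiv e).trans (h.trans (.of_equiv e'.symm))⟩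
  | succ n ih =>
    rintro M M' _ _ _ _ ⟨Q, C, f, g, h1, h2, h3⟩ ⟨Q', C', f', g', h1', h2', h3'⟩
    rw [← ih h3 h3']
    exact ⟨StableRetract.cokernel h1 h2 h1' h2'.2.2, StableRetract.kernel h1 h2 h1' h2'.2.1⟩

/-! ### Dominant and codominant dimension from arbitrary resolutions. -/

/-- `M` has dominant dimension at least `n`, tested on not necessarily minimal coresolutions. -/
def DomGE (B : Type u) [Ring B] (n : ℕ) (M : Type u) [AddCommGroup M] [Module B M] : Prop :=
  ∃ S : ModuleCat.{u} B, Chain B n M S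

/-- `S` has codominant dimension at least `n`, tested on not necessarily minimal resolutions. -/
def CoGE (B : Type u) [Ring B] (n : ℕ) (S : Type u) [AddCommGroup S] [Module B S] : Prop :=
  ∃ M : ModuleCat.{u} B, CoChain B n M S

theorem Chain.domGE {n : ℕ} (h : Chain B n M S) : DomGE B n M := ⟨ModuleCat.of B S, h⟩

theorem CoChain.coGE {n : ℕ} (h : CoChain B n M S) : CoGE B n S := ⟨ModuleCat.of B M, h⟩

theorem DomGE.zero : DomGE B 0 M := ⟨ModuleCat.of B M, ⟨.refl B M⟩⟩

theorem CoGE.zero : CoGE B 0 M := ⟨ModuleCat.of B M, ⟨.refl B M⟩⟩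

theorem domGE_succ {n : ℕ} : DomGE B (n + 1) M ↔ ∃ (Q C : ModuleCat.{u} B) (f : M →ₗ[B] Q)
    (g : Q →ₗ[B] C), IsSES f g ∧ FPI B Q ∧ DomGE B n C :=
  ⟨fun ⟨S, Q, C, f, g, h1, h2, h3⟩ => ⟨Q, C, f, g, h1, h2, S, h3⟩,
    fun ⟨Q, C, f, g, h1, h2, S, h3⟩ => ⟨S, Q, C, f, g, h1, h2, h3⟩⟩

theorem coGE_succ {n : ℕ} : CoGE B (n + 1) S ↔ ∃ (K Q : ModuleCat.{u} B) (f : K →ₗ[B] Q)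
    (g : Q →ₗ[B] S), IsSES f g ∧ FPI B Q ∧ CoGE B n K :=
  ⟨fun ⟨S, Q, C, f, g, h1, h2, h3⟩ => ⟨Q, C, f, g, h1, h2, S, h3⟩,
    fun ⟨Q, C, f, g, h1, h2, S, h3⟩ => ⟨S, Q, C, f, g, h1, h2, h3⟩⟩

theorem DomGE.of_succ {n : ℕ} : ∀ {M : Type u} [AddCommGroup M] [Module B M],
    DomGE B (n + 1) M → DomGE B n M := by
  induction n with
  | zero => exact fun _ => .zero
  | succ n ih =>
    intro M _ _ h
    obtain ⟨Q, C, f, g, h1, h2, h3⟩ := domGE_succ.1 h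
    exact domGE_succ.2 ⟨Q, C, f, g, h1, h2, ih h3⟩

theorem DomGE.mono {m n : ℕ} (hmn : m ≤ n) (h : DomGE B n M) : DomGE B m M := by
  induction n, hmn using Nat.le_induction with
  | base => exact h
  | succ n _ ih => exact ih h.of_succ

theorem CoGE.of_succ {n : ℕ} : ∀ {M : Type u} [AddCommGroup M] [Module B M],
    CoGE B (n + 1) M → CoGE B n M := by
  induction n with
  | zero => exact fun _ => .zero
  | succ n ih =>
    intro M _ _ h
    obtain ⟨Q, C, f, g, h1, h2, h3⟩ := coGE_succ.1 h
    exact coGE_succ.2 ⟨Q, C, f, g, h1, h2, ih h3⟩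

theorem CoGE.mono {m n : ℕ} (hmn : m ≤ n) (h : CoGE B n M) : CoGE B m M := by
  induction n, hmn using Nat.le_induction with
  | base => exact h
  | succ n _ ih => exact ih h.of_succ

/-- Embed `M` through `N × Q₀` into `Q × Q₀`. By `StableRetract.cokernel` the new cokernel is a
stable retract of the old one, so the induction continues. In particular the choice of embedding
does not matter. -/
theorem DomGE.of_stableRetract {n : ℕ} : ∀ {M N : Type u} [AddCommGroup M] [Module B M]
    [AddCommGroup N] [Module B N], StableRetract B M N → DomGE B n N → DomGE B n M := by
  induction n with
  | zero => exact fun _ _ => .zero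
  | succ n ih =>
    intro M N _ _ _ _ h hN
    obtain ⟨Q, C, f, g, h1, h2, h3⟩ := domGE_succ.1 hN
    obtain ⟨Q₀, s, t, hQ₀, hst⟩ := id h
    have hinj : Function.Injective (f.prodMap (LinearMap.id : Q₀ →ₗ[B] Q₀) ∘ₗ s) := by
      intro x y hxy
      have h4 : f (s x).1 = f (s y).1 ∧ (s x).2 = (s y).2 := Prod.ext_iff.1 hxy
      replace h4 : s x = s y := Prod.ext (h1.inj h4.1) h4.2
      have h5 : ∀ x, t (s x) = x := LinearMap.congr_fun hst
      rw [← h5 x, h4, h5]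
    have h6 := isSES_mkQ hinj
    exact domGE_succ.2 ⟨ModuleCat.of B (Q × Q₀), ModuleCat.of B _, _, _, h6, h2.prod hQ₀,
      ih (h.cokernel h6 (h2.prod hQ₀) h1 h2.2.2) h3⟩

theorem CoGE.of_stableRetract {n : ℕ} : ∀ {M N : Type u} [AddCommGroup M] [Module B M]
    [AddCommGroup N] [Module B N], StableRetract B M N → CoGE B n N → CoGE B n M := by
  induction n with
  | zero => exact fun _ _ => .zero
  | succ n ih =>
    intro M N _ _ _ _ h hN
    obtain ⟨K, Q, f, g, h1, h2, h3⟩ := coGE_succ.1 hN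
    obtain ⟨Q₀, s, t, hQ₀, hst⟩ := id h
    have hsurj : Function.Surjective (t ∘ₗ g.prodMap (LinearMap.id : Q₀ →ₗ[B] Q₀)) := by
      intro x
      obtain ⟨q, hq⟩ := h1.surj (s x).1
      refine ⟨(q, (s x).2), ?_⟩
      change t (g q, (s x).2) = x
      rw [hq]
      exact LinearMap.congr_fun hst x
    have h6 := isSES_ker hsurj
    exact coGE_succ.2 ⟨ModuleCat.of B _, ModuleCat.of B (Q × Q₀), _, _, h6, h2.prod hQ₀,
      ih (h.kernel h6 (h2.prod hQ₀) h1 h2.2.1) h3⟩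

theorem DomGE.pi {n : ℕ} (h : DomGE B n M) (m : ℕ) : DomGE B n (Fin m → M) := by
  obtain ⟨S, h⟩ := h
  exact (h.pi m).domGE

theorem CoGE.pi {n : ℕ} (h : CoGE B n M) (m : ℕ) : CoGE B n (Fin m → M) := by
  obtain ⟨S, h⟩ := h
  exact (h.chain.pi m).coChain.coGE

end Chains
end AuslanderGorenstein

namespace AuslanderGorenstein

/-! ### Projective and injective dimension along chains. -/

section Dimensions

variable {B : Type u} [Ring B]
variable {M N P Q C S : Type u} [AddCommGroup M] [Module B M] [AddCommGroup N] [Module B N]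
  [AddCommGroup P] [Module B P] [AddCommGroup Q] [Module B Q] [AddCommGroup C] [Module B C]
  [AddCommGroup S] [Module B S]

/-- The projective dimension of `M` is less than `n`. -/
abbrev PdLT (B : Type u) [Ring B] (M : Type u) [AddCommGroup M] [Module B M] (n : ℕ) : Prop :=
  HasProjectiveDimensionLT (ModuleCat.of B M) n

/-- The injective dimension of `M` is less than `n`. -/
abbrev IdLT (B : Type u) [Ring B] (M : Type u) [AddCommGroup M] [Module B M] (n : ℕ) : Prop :=
  HasInjectiveDimensionLT (ModuleCat.of B M) n

theorem pdLT_one : PdLT B M 1 ↔ Module.Projective B M := by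
  rw [IsProjective.iff_projective]
  exact projective_iff_hasProjectiveDimensionLT_one.symm

theorem idLT_one : IdLT B M 1 ↔ Module.Injective B M := by
  rw [Module.injective_iff_injective_object]
  exact injective_iff_hasInjectiveDimensionLT_one.symm

theorem PdLT.mono {m n : ℕ} (hmn : m ≤ n) (h : PdLT B M m) : PdLT B M n :=
  hasProjectiveDimensionLT_of_ge _ m n hmn

theorem IdLT.mono {m n : ℕ} (hmn : m ≤ n) (h : IdLT B M m) : IdLT B M n :=
  hasInjectiveDimensionLT_of_ge _ m n hmn

theorem IsSES.pdLT_left {f : M →ₗ[B] Q} {g : Q →ₗ[B] C} (h : IsSES f g) {n : ℕ}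
    (hQ : Module.Projective B Q) (hC : PdLT B C (n + 2)) : PdLT B M (n + 1) :=
  h.shortExact.hasProjectiveDimensionLT_X₁ (n + 1) ((pdLT_one.2 hQ).mono (by lia)) hC

theorem IsSES.pdLT_right {f : M →ₗ[B] Q} {g : Q →ₗ[B] C} (h : IsSES f g) {n : ℕ}
    (hQ : Module.Projective B Q) (hM : PdLT B M (n + 1)) : PdLT B C (n + 2) :=
  h.shortExact.hasProjectiveDimensionLT_X₃ (n + 1) hM ((pdLT_one.2 hQ).mono (by lia))

theorem IsSES.idLT_right {f : M →ₗ[B] Q} {g : Q →ₗ[B] C} (h : IsSES f g) {n : ℕ}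
    (hQ : Module.Injective B Q) (hM : IdLT B M (n + 2)) : IdLT B C (n + 1) :=
  h.shortExact.hasInjectiveDimensionLT_X₃ (n + 1) ((idLT_one.2 hQ).mono (by lia)) hM

theorem IsSES.idLT_left {f : M →ₗ[B] Q} {g : Q →ₗ[B] C} (h : IsSES f g) {n : ℕ}
    (hQ : Module.Injective B Q) (hC : IdLT B C (n + 1)) : IdLT B M (n + 2) :=
  h.shortExact.hasInjectiveDimensionLT_X₁ (n + 1) hC ((idLT_one.2 hQ).mono (by lia))

theorem PdLT.congr {n : ℕ} (e : M ≃ₗ[B] N) (h : PdLT B M n) : PdLT B N n :=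
  hasProjectiveDimensionLT_of_iso e.toModuleIso n

theorem IdLT.congr {n : ℕ} (e : M ≃ₗ[B] N) (h : IdLT B M n) : IdLT B N n :=
  hasInjectiveDimensionLT_of_iso e.toModuleIso n

theorem isSES_inl_snd : IsSES (LinearMap.inl B M N) (LinearMap.snd B M N) :=
  ⟨LinearMap.inl_injective, LinearMap.snd_surjective, .inl_snd⟩

/-- A split monomorphism of modules as a retract in the category of modules. -/
def retractOf (s : M →ₗ[B] N) (t : N →ₗ[B] M) (h : t ∘ₗ s = LinearMap.id) :
    Retract (ModuleCat.of B M) (ModuleCat.of B N) where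
  i := ModuleCat.ofHom s
  r := ModuleCat.ofHom t
  retract := by ext x; exact LinearMap.congr_fun h x

theorem StableRetract.pdLT {n : ℕ} (h : StableRetract B M N) (hN : PdLT B N (n + 1)) :
    PdLT B M (n + 1) := by
  obtain ⟨Q, s, t, hQ, hst⟩ := h
  have : PdLT B (N × Q) (n + 1) := isSES_inl_snd.shortExact.hasProjectiveDimensionLT_X₂ (n + 1) hN
    ((pdLT_one.2 hQ.2.1).mono (by lia))
  exact (retractOf s t hst).hasProjectiveDimensionLT (n + 1)

theorem StableRetract.idLT {n : ℕ} (h : StableRetract B M N) (hN : IdLT B N (n + 1)) :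
    IdLT B M (n + 1) := by
  obtain ⟨Q, s, t, hQ, hst⟩ := h
  have : IdLT B (N × Q) (n + 1) := isSES_inl_snd.shortExact.hasInjectiveDimensionLT_X₂ (n + 1) hN
    ((idLT_one.2 hQ.2.2).mono (by lia))
  exact (retractOf s t hst).hasInjectiveDimensionLT (n + 1)

/-- Dimension shift: `n + 1` bounds the dimension by `n`, and each of the `n` steps lowers the bound
by one. -/
theorem Chain.injective {n : ℕ} : ∀ {M : Type u} [AddCommGroup M] [Module B M],
    Chain B n M S → IdLT B M (n + 1) → Module.Injective B S := by
  induction n with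
  | zero => exact fun ⟨e⟩ h => idLT_one.1 (h.congr e)
  | succ n ih =>
    rintro M _ _ ⟨Q, C, f, g, h1, h2, h3⟩ h
    exact ih h3 (h1.idLT_right h2.2.2 h)

theorem Chain.idLT {n : ℕ} (hS : Module.Injective B S) :
    ∀ {M : Type u} [AddCommGroup M] [Module B M], Chain B n M S → IdLT B M (n + 1) := by
  induction n with
  | zero => exact fun ⟨e⟩ => (idLT_one.2 hS).congr e.symm
  | succ n ih =>
    rintro M _ _ ⟨Q, C, f, g, h1, h2, h3⟩
    exact h1.idLT_left h2.2.2 (ih h3)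

theorem CoChain.projective {n : ℕ} : ∀ {S : Type u} [AddCommGroup S] [Module B S],
    CoChain B n M S → PdLT B S (n + 1) → Module.Projective B M := by
  induction n with
  | zero => exact fun ⟨e⟩ h => pdLT_one.1 (h.congr e.symm)
  | succ n ih =>
    rintro S _ _ ⟨Q, C, f, g, h1, h2, h3⟩ h
    exact ih h3 (h1.pdLT_left h2.2.1 h)

theorem CoChain.pdLT {n : ℕ} (hM : Module.Projective B M) :
    ∀ {S : Type u} [AddCommGroup S] [Module B S], CoChain B n M S → PdLT B S (n + 1) := by
  induction n with
  | zero => exact fun ⟨e⟩ => (pdLT_one.2 hM).congr e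
  | succ n ih =>
    rintro S _ _ ⟨Q, C, f, g, h1, h2, h3⟩
    exact h1.pdLT_right h2.2.1 (ih h3)

theorem IsSES.finite_left [IsNoetherianRing B] {f : M →ₗ[B] Q} {g : Q →ₗ[B] C}
    (h : IsSES f g) [Module.Finite B Q] : Module.Finite B M :=
  Module.Finite.of_injective f h.inj

theorem IsSES.finite_right {f : M →ₗ[B] Q} {g : Q →ₗ[B] C}
    (h : IsSES f g) [Module.Finite B Q] : Module.Finite B C :=
  Module.Finite.of_surjective g h.surj

theorem Chain.finite {n : ℕ} : ∀ {M : Type u} [AddCommGroup M] [Module B M] [Module.Finite B M],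
    Chain B n M S → Module.Finite B S := by
  induction n with
  | zero => exact fun ⟨e⟩ => Module.Finite.equiv e
  | succ n ih =>
    rintro M _ _ _ ⟨Q, C, f, g, h1, h2, h3⟩
    have := h2.1
    have := h1.finite_right
    exact ih h3

theorem CoChain.finite [IsNoetherianRing B] {n : ℕ} :
    ∀ {S : Type u} [AddCommGroup S] [Module B S] [Module.Finite B S],
    CoChain B n M S → Module.Finite B M := by
  induction n with
  | zero => exact fun ⟨e⟩ => Module.Finite.equiv e.symm
  | succ n ih =>
    rintro M _ _ _ ⟨Q, C, f, g, h1, h2, h3⟩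
    have := h2.1
    have := h1.finite_left
    exact ih h3

/-- If the injective dimension of a module is smaller than its dominant dimension, the module is
projective and injective. -/
theorem isProjInj_of_idLT {n : ℕ} : ∀ {M : Type u} [AddCommGroup M] [Module B M],
    IdLT B M (n + 1) → DomGE B (n + 1) M → IsProjInj B M := by
  induction n with
  | zero =>
    intro M _ _ h1 h2
    obtain ⟨Q, C, f, g, h3, h4, -⟩ := domGE_succ.1 h2
    obtain ⟨⟨t, ht⟩, -⟩ := h3.split_of_injective (idLT_one.1 h1)
    exact (h4.of_retract f t ht).2
  | succ n ih =>
    intro M _ _ h1 h2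
    obtain ⟨Q, C, f, g, h3, h4, h5⟩ := domGE_succ.1 h2
    -- By induction the cokernel `C` is projective, so `M` is a summand of the projective-injective
    -- `Q`.
    obtain ⟨⟨t, ht⟩, -⟩ := h3.split_of_projective (ih (h3.idLT_right h4.2.2 h1) h5).1
    exact (h4.of_retract f t ht).2

/-- If the projective dimension of a module is smaller than its codominant dimension, the module
is projective and injective. -/
theorem isProjInj_of_pdLT {n : ℕ} : ∀ {M : Type u} [AddCommGroup M] [Module B M],
    PdLT B M (n + 1) → CoGE B (n + 1) M → IsProjInj B M := by
  induction n with
  | zero =>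
    intro M _ _ h1 h2
    obtain ⟨Q, C, f, g, h3, h4, -⟩ := coGE_succ.1 h2
    obtain ⟨-, s, hs⟩ := h3.split_of_projective (pdLT_one.1 h1)
    exact (h4.of_retract s g hs).2
  | succ n ih =>
    intro M _ _ h1 h2
    obtain ⟨Q, C, f, g, h3, h4, h5⟩ := coGE_succ.1 h2
    obtain ⟨-, s, hs⟩ := h3.split_of_injective (ih (h3.pdLT_left h4.2.1 h1) h5).2
    exact (h4.of_retract s g hs).2

/-! ### Coresolutions with prescribed terms, and modules of finite projective dimension. -/

/-- `M` has a coresolution whose first `n` terms satisfy `𝒯` and whose `n`-th cosyzygy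
satisfies `𝒮`. -/
def Cores (𝒯 𝒮 : ModuleCat.{u} B → Prop) :
    ℕ → (M : Type u) → [AddCommGroup M] → [Module B M] → Prop
  | 0, M, _, _ => 𝒮 (ModuleCat.of B M)
  | n + 1, M, _, _ => ∃ (Q C : ModuleCat.{u} B) (f : M →ₗ[B] Q) (g : Q →ₗ[B] C),
      IsSES f g ∧ 𝒯 Q ∧ Cores 𝒯 𝒮 n C

theorem cores_iff_domGE {n : ℕ} : ∀ {M : Type u} [AddCommGroup M] [Module B M],
    Cores (B := B) (fun Q => FPI B Q) (fun _ => True) n M ↔ DomGE B n M := by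
  induction n with
  | zero => exact fun {_} _ _ => ⟨fun _ => .zero, fun _ => trivial⟩
  | succ n ih =>
    intro M _ _
    rw [domGE_succ]
    exact exists_congr fun Q => exists_congr fun C => exists_congr fun f => exists_congr fun g =>
      and_congr_right fun _ => and_congr_right fun _ => ih

section Cores

variable {𝒯 𝒮 : ModuleCat.{u} B → Prop}

/-- The horseshoe construction: injectivity of the terms over `M` extends `a` along `f`, and the
cokernels of the three embeddings form a short exact sequence to which induction applies. -/
theorem Cores.extension (h𝒯 : ∀ Q, 𝒯 Q → Module.Injective B Q)
    (hprod : ∀ Q Q', 𝒯 Q → 𝒯 Q' → 𝒯 (ModuleCat.of B (Q × Q')))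
    (h𝒮 : ∀ (M N C : ModuleCat.{u} B) (f : M →ₗ[B] N) (g : N →ₗ[B] C), IsSES f g →
      𝒮 M → 𝒮 C → 𝒮 N) {n : ℕ} :
    ∀ {M N C : Type u} [AddCommGroup M] [Module B M] [AddCommGroup N] [Module B N]
      [AddCommGroup C] [Module B C] {f : M →ₗ[B] N} {g : N →ₗ[B] C}, IsSES f g →
      Cores 𝒯 𝒮 n M → Cores 𝒯 𝒮 n C → Cores 𝒯 𝒮 n N := by
  induction n with
  | zero =>
    intro M N C _ _ _ _ _ _ f g h hM hC
    exact h𝒮 (.of B M) (.of B N) (.of B C) f g h hM hC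
  | succ n ih =>
    intro M N C _ _ _ _ _ _ f g h hM hC
    obtain ⟨Q₁, C₁, a, p₁, h1, hQ₁, hC₁⟩ := hM
    obtain ⟨Q₂, C₂, b, p₂, h2, hQ₂, hC₂⟩ := hC
    have := h𝒯 _ hQ₁
    obtain ⟨k, hk⟩ := Module.Injective.extend h.inj a
    replace hk : ∀ m, k (f m) = a m := LinearMap.congr_fun hk
    let j : N →ₗ[B] Q₁ × Q₂ := k.prod (b ∘ₗ g)
    have hj : Function.Injective j := by
      rw [injective_iff_map_eq_zero]
      intro x hx
      have hx1 : k x = 0 := congrArg Prod.fst hx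
      have hx2 : b (g x) = 0 := congrArg Prod.snd hx
      obtain ⟨m, rfl⟩ := (h.exact x).1 (h2.inj (hx2.trans (map_zero b).symm))
      rw [hk] at hx1
      rw [h1.inj (hx1.trans (map_zero a).symm), map_zero]
    have hD := isSES_mkQ hj
    set π := (LinearMap.range j).mkQ
    obtain ⟨α, hα⟩ := h1.desc (π ∘ₗ LinearMap.inl B Q₁ Q₂) fun m => by
      have : LinearMap.inl B Q₁ Q₂ (a m) = j (f m) :=
        Prod.ext (hk m).symm (by simp [j, h.exact.apply_apply_eq_zero])
      rw [LinearMap.comp_apply, this]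
      exact hD.exact.apply_apply_eq_zero _
    obtain ⟨γ, hγ⟩ := hD.desc (p₂ ∘ₗ LinearMap.snd B Q₁ Q₂) fun x =>
      h2.exact.apply_apply_eq_zero _
    have hSES : IsSES α γ := by
      refine ⟨?_, fun y => ?_, fun y => ⟨fun hy => ?_, ?_⟩⟩
      · rw [injective_iff_map_eq_zero]
        intro c hc
        obtain ⟨q, rfl⟩ := h1.surj c
        rw [hα] at hc
        obtain ⟨x, hx⟩ := (hD.exact _).1 hc
        have hx1 : k x = q := congrArg Prod.fst hx
        have hx2 : b (g x) = 0 := congrArg Prod.snd hx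
        obtain ⟨m, rfl⟩ := (h.exact x).1 (h2.inj (hx2.trans (map_zero b).symm))
        rw [← hx1, hk, h1.exact.apply_apply_eq_zero]
      · obtain ⟨q, rfl⟩ := h2.surj y
        exact ⟨π (0, q), hγ _⟩
      · obtain ⟨⟨q₁, q₂⟩, rfl⟩ := hD.surj y
        rw [hγ] at hy
        obtain ⟨c, hc⟩ := (h2.exact q₂).1 hy
        obtain ⟨x, rfl⟩ := h.surj c
        refine ⟨p₁ (q₁ - k x), ?_⟩
        rw [hα, ← sub_eq_zero, LinearMap.comp_apply, ← map_sub]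
        have : LinearMap.inl B Q₁ Q₂ (q₁ - k x) - (q₁, q₂) = - j x :=
          Prod.ext (by simp [j]) (by simp [j, hc])
        rw [this, map_neg, hD.exact.apply_apply_eq_zero, neg_zero]
      · rintro ⟨c, rfl⟩
        obtain ⟨q, rfl⟩ := h1.surj c
        rw [hα]
        exact (hγ _).trans (map_zero p₂)
    exact ⟨.of B (Q₁ × Q₂), .of B _, j, π, hD, hprod _ _ hQ₁ hQ₂, ih hSES hC₁ hC₂⟩

/-- Push `M → N` out along `M → T`. The pushout is an extension of `C` by the injective `T`, hence
is `T × C`; it is also an extension of the first cosyzygy of `M` by `N`, so the horseshoe applies.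
The summand `T` is the price. -/
theorem Cores.cokernel (h𝒯 : ∀ Q, 𝒯 Q → Module.Injective B Q)
    (hprod : ∀ Q Q', 𝒯 Q → 𝒯 Q' → 𝒯 (ModuleCat.of B (Q × Q')))
    (h𝒮 : ∀ (M N C : ModuleCat.{u} B) (f : M →ₗ[B] N) (g : N →ₗ[B] C), IsSES f g →
      𝒮 M → 𝒮 C → 𝒮 N) {n : ℕ} {f : M →ₗ[B] N} {g : N →ₗ[B] C} (h : IsSES f g)
    (hM : Cores 𝒯 𝒮 (n + 1) M) (hN : Cores 𝒯 𝒮 n N) :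
    ∃ T : ModuleCat.{u} B, 𝒯 T ∧ Cores 𝒯 𝒮 n (T × C) := by
  obtain ⟨T, K, a, p, h1, hT, hK⟩ := hM
  have := h𝒯 _ hT
  obtain ⟨k, hk⟩ := Module.Injective.extend h.inj a
  replace hk : ∀ m, k (f m) = a m := LinearMap.congr_fun hk
  obtain ⟨l, hl⟩ := h.desc (p ∘ₗ k) fun m => by simp [hk, h1.exact.apply_apply_eq_zero]
  have hSES : IsSES (k.prod g) (p.coprod (-l)) := by
    refine ⟨?_, fun y => ?_, fun y => ⟨fun hy => ?_, ?_⟩⟩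
    · rw [injective_iff_map_eq_zero]
      intro x hx
      have hx1 : k x = 0 := congrArg Prod.fst hx
      obtain ⟨m, rfl⟩ := (h.exact x).1 (congrArg Prod.snd hx)
      rw [hk] at hx1
      rw [h1.inj (hx1.trans (map_zero a).symm), map_zero]
    · obtain ⟨t, rfl⟩ := h1.surj y
      exact ⟨(t, 0), by simp⟩
    · obtain ⟨t, c⟩ := y
      obtain ⟨x, rfl⟩ := h.surj c
      have hy' : p (t - k x) = 0 := by
        have := hl x
        simp_all [← sub_eq_add_neg]
      obtain ⟨m, hm⟩ := (h1.exact _).1 hy'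
      refine ⟨x + f m, Prod.ext ?_ ?_⟩
      · simp [hk, hm]
      · simp [h.exact.apply_apply_eq_zero]
    · rintro ⟨x, rfl⟩
      simp [hl]
  exact ⟨T, hT, .extension h𝒯 hprod h𝒮 hSES hN hK⟩

end Cores

/-- If all finitely generated projective modules have dominant dimension at least `r`, modules of
projective dimension at most `i` have dominant dimension at least `r - i`. -/
theorem domGE_of_pdLT [IsNoetherianRing B] {r : ℕ}
    (hB : ∀ (P : Type u) [AddCommGroup P] [Module B P], Module.Finite B P →
      Module.Projective B P → DomGE B r P) {i : ℕ} :
    ∀ {M : Type u} [AddCommGroup M] [Module B M] [Module.Finite B M],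
      PdLT B M (i + 1) → DomGE B (r - i) M := by
  induction i with
  | zero => exact fun {_} _ _ hM h => hB _ hM (pdLT_one.1 h)
  | succ i ih =>
    intro M _ _ _ h
    obtain ⟨n, p, hp⟩ := Module.Finite.exists_fin' B M
    have hSES := isSES_ker hp
    have hK := ih (hSES.pdLT_left inferInstance h)
    -- For `r ≤ i + 1` the truncated difference is zero and nothing is claimed. Otherwise the syzygy
    -- has one more step available than is needed, and `Cores.cokernel` spends it.
    by_cases hr : r ≤ i + 1
    · rw [Nat.sub_eq_zero_of_le hr]
      exact .zero
    have hr' : r - i = (r - (i + 1)) + 1 := by lia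
    rw [hr', ← cores_iff_domGE] at hK
    have hP := (hB (Fin n → B) inferInstance inferInstance).mono (Nat.sub_le r (i + 1))
    rw [← cores_iff_domGE] at hP
    obtain ⟨T, hT, hTM⟩ := Cores.cokernel (fun Q hQ => hQ.2.2) (fun Q Q' hQ hQ' => hQ.prod hQ')
      (fun _ _ _ _ _ _ _ _ => trivial) hSES hK hP
    exact (cores_iff_domGE.1 hTM).of_stableRetract
      (.of_retract (LinearMap.inr B T M) (LinearMap.snd B T M) (by ext; simp))

theorem StableRetract.prod {M' N' : Type u} [AddCommGroup M'] [Module B M'] [AddCommGroup N']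
    [Module B N'] (h : StableRetract B M N) (h' : StableRetract B M' N') :
    StableRetract B (M × M') (N × N') := by
  obtain ⟨Q, s, t, hQ, hst⟩ := h
  obtain ⟨Q', s', t', hQ', hst'⟩ := h'
  have h1 : ∀ y, t' (s' y) = y := LinearMap.congr_fun hst'
  have h2 : ∀ y, t (s y) = y := LinearMap.congr_fun hst
  let e := LinearEquiv.prodProdProdComm B N Q N' Q'
  refine ⟨.of B (Q × Q'), e.toLinearMap ∘ₗ s.prodMap s',
    t.prodMap t' ∘ₗ e.symm.toLinearMap, hQ.prod hQ', ?_⟩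
  refine LinearMap.ext fun x => ?_
  change t.prodMap t' (e.symm (e (s.prodMap s' x))) = x
  rw [e.symm_apply_apply]
  exact Prod.ext (h2 _) (h1 _)

/-- The finitely generated injective modules in `add⁺(S)`. -/
def InjAddPI (S : Type u) [AddCommGroup S] [Module B S] (T : ModuleCat.{u} B) : Prop :=
  Module.Injective B T ∧ ∃ n : ℕ, StableRetract B T (Fin n → S)

theorem InjAddPI.prod (T T' : ModuleCat.{u} B) (h : InjAddPI S T) (h' : InjAddPI S T') :
    InjAddPI S (ModuleCat.of B (T × T')) := by
  obtain ⟨h1, m, h2⟩ := h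
  obtain ⟨h1', n, h2'⟩ := h'
  exact ⟨inferInstance, m + n, (h2.prod h2').trans (.of_equiv
    ((LinearEquiv.sumArrowLequivProdArrow (Fin m) (Fin n) B S).symm.trans
      (LinearEquiv.funCongrLeft B S finSumFinEquiv.symm)))⟩

theorem InjAddPI.of_fpi (T : ModuleCat.{u} B) (hT : FPI B T) : InjAddPI S T :=
  ⟨hT.2.2, 0, T, LinearMap.inr B (Fin 0 → S) T, LinearMap.snd B (Fin 0 → S) T, hT, by ext; simp⟩

/-- The property of being zero. -/
def IsZeroModule (T : ModuleCat.{u} B) : Prop := Subsingleton T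

theorem IsZeroModule.extension (M N C : ModuleCat.{u} B) (f : M →ₗ[B] N) (g : N →ₗ[B] C)
    (h : IsSES f g) (hM : IsZeroModule M) (hC : IsZeroModule C) : IsZeroModule N := by
  have : Subsingleton M := hM
  have : Subsingleton C := hC
  refine subsingleton_of_forall_eq 0 fun x => ?_
  obtain ⟨y, rfl⟩ := (h.exact x).1 (Subsingleton.elim _ _)
  rw [Subsingleton.elim y 0, map_zero]

theorem cores_of_injAddPI {n : ℕ} (hM : InjAddPI (B := B) S (ModuleCat.of B M)) :
    Cores (InjAddPI (B := B) S) IsZeroModule (n + 1) M := by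
  have h0 : ∀ n, Cores (B := B) (InjAddPI S) IsZeroModule n PUnit.{u + 1} := by
    intro n
    induction n with
    | zero => exact inferInstanceAs (Subsingleton PUnit.{u + 1})
    | succ n ih =>
      exact ⟨.of B PUnit.{u + 1}, .of B PUnit.{u + 1}, LinearMap.id, 0,
        ⟨fun _ _ h => h, fun x => ⟨x, rfl⟩, fun x => ⟨fun _ => ⟨x, rfl⟩, fun _ => rfl⟩⟩,
        .of_fpi _ .of_subsingleton, ih⟩
  exact ⟨.of B M, .of B PUnit.{u + 1}, LinearMap.id, 0,
    ⟨fun _ _ h => h, fun x => ⟨0, rfl⟩, fun x => ⟨fun _ => ⟨x, rfl⟩, fun _ => rfl⟩⟩, hM, h0 n⟩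

/-- Padding by a zero term makes up for the step that `Cores.cokernel` consumes, so the length stays
fixed in an induction on projective dimension. -/
theorem Cores.succ_of_zero {n : ℕ} : ∀ {M : Type u} [AddCommGroup M] [Module B M],
    Cores (InjAddPI (B := B) S) IsZeroModule n M →
      Cores (InjAddPI (B := B) S) IsZeroModule (n + 1) M := by
  induction n with
  | zero =>
    intro M _ _ h
    have : Subsingleton M := h
    exact cores_of_injAddPI (.of_fpi _ .of_subsingleton)
  | succ n ih =>
    rintro M _ _ ⟨Q, C, f, g, h1, h2, h3⟩
    exact ⟨Q, C, f, g, h1, h2, ih h3⟩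

theorem Chain.cores {T : Type u} [AddCommGroup T] [Module B T] {n : ℕ}
    (hT : InjAddPI (B := B) S (ModuleCat.of B T)) :
    ∀ {M : Type u} [AddCommGroup M] [Module B M],
      Chain B n M T → Cores (InjAddPI (B := B) S) IsZeroModule (n + 1) M := by
  induction n with
  | zero =>
    rintro M _ _ ⟨e⟩
    obtain ⟨h1, m, h2⟩ := hT
    exact cores_of_injAddPI ⟨.of_retract e.toLinearMap e.symm.toLinearMap (by ext; simp), m,
      (StableRetract.of_equiv e).trans h2⟩
  | succ n ih =>
    rintro M _ _ ⟨Q, C, f, g, h1, h2, h3⟩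
    exact ⟨Q, C, f, g, h1, .of_fpi _ h2, ih h3⟩

/-- Finite coresolutions by injectives in add⁺(S) pass from projectives to modules of finite
projective dimension, one syzygy at a time. Since `Cores.cokernel` returns the module only with a
summand `T`, that summand is carried along: the sequence used is 0 → T ⊕ ker p → T ⊕ Bⁿ → M → 0. -/
theorem exists_cores_of_pdLT [IsNoetherianRing B] {r : ℕ}
    (hB : ∀ (P : Type u) [AddCommGroup P] [Module B P], Module.Finite B P →
      Module.Projective B P → Cores (InjAddPI (B := B) S) IsZeroModule (r + 1) P) {i : ℕ} :
    ∀ {M : Type u} [AddCommGroup M] [Module B M] [Module.Finite B M], PdLT B M (i + 1) →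
      ∃ T : ModuleCat.{u} B, InjAddPI (B := B) S T ∧
        Cores (InjAddPI (B := B) S) IsZeroModule (r + 1) (T × M) := by
  induction i with
  | zero =>
    intro M _ _ hM h
    refine ⟨.of B PUnit.{u + 1}, .of_fpi _ .of_subsingleton, hB _ inferInstance ?_⟩
    have := pdLT_one.1 h
    infer_instance
  | succ i ih =>
    intro M _ _ _ h
    obtain ⟨n, p, hp⟩ := Module.Finite.exists_fin' B M
    have hSES := isSES_ker hp
    obtain ⟨T, hT, hTK⟩ := ih (hSES.pdLT_left inferInstance h)
    have hTP : Cores (InjAddPI (B := B) S) IsZeroModule (r + 1) (T × (Fin n → B)) :=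
      .extension (fun _ h => h.1) InjAddPI.prod IsZeroModule.extension isSES_inl_snd
        (cores_of_injAddPI hT) (hB _ inferInstance inferInstance)
    have hSES' : IsSES (LinearMap.id.prodMap (LinearMap.ker p).subtype :
        T × LinearMap.ker p →ₗ[B] T × (Fin n → B)) (p ∘ₗ LinearMap.snd B T (Fin n → B)) := by
      refine ⟨?_, hp.comp Prod.snd_surjective, ?_⟩
      · exact Function.Injective.prodMap (fun _ _ h => h) (Submodule.subtype_injective _)
      · rintro ⟨t, x⟩
        constructor
        · intro hx
          exact ⟨(t, ⟨x, hx⟩), rfl⟩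
        · rintro ⟨⟨t', x', hx'⟩, h⟩
          rw [← h]
          exact hx'
    exact Cores.cokernel (fun _ h => h.1) InjAddPI.prod IsZeroModule.extension hSES'
      hTK.succ_of_zero hTP

/-- If the regular module has an injective coresolution of length `r` with projective terms except
for the last term `S`, every finitely generated injective module of finite projective dimension
lies in `add⁺(S)`. -/
theorem exists_stableRetract_of_injective [IsNoetherianRing B] {r : ℕ} (hS : Chain B r B S)
    (hid : IdLT B B (r + 1)) {i : ℕ} [Module.Finite B M] (hM : Module.Injective B M)
    (hpd : PdLT B M (i + 1)) : ∃ n : ℕ, StableRetract B M (Fin n → S) := by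
  have hSinj : Module.Injective B S := hS.injective hid
  have hB : ∀ (P : Type u) [AddCommGroup P] [Module B P], Module.Finite B P →
      Module.Projective B P → Cores (InjAddPI (B := B) S) IsZeroModule (r + 1) P := by
    intro P _ _ _ _
    obtain ⟨n, s, t, -, -, hst⟩ := Module.Finite.exists_comp_eq_id_of_projective B P
    have hP := StableRetract.of_retract t s hst
    have hn := hS.pi n
    obtain ⟨T, hT⟩ := hn.domGE.of_stableRetract hP
    -- `P` is a summand of `Bⁿ`, so the end of its own chain is a stable retract of `Sⁿ`; being in
    -- add⁺ of an injective module, it is injective.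
    have hTS := (hT.stableRetract hn).1 hP
    refine hT.cores ⟨?_, n, hTS⟩
    have := Module.Injective.finPi (B := B) (M := S) n
    exact idLT_one.1 (hTS.idLT (n := 0) (idLT_one.2 this))
  obtain ⟨T, hT, Q, C, f, g, h1, ⟨-, n, h2⟩, -⟩ := exists_cores_of_pdLT hB hpd
  have := hT.1
  -- Only the first term of the coresolution matters: `T × M` is injective, hence a summand of `Q`,
  -- which lies in add⁺(S).
  obtain ⟨⟨t, ht⟩, -⟩ := h1.split_of_injective inferInstance
  have h3 : StableRetract B M (T × M) :=
    .of_retract (LinearMap.inr B T M) (LinearMap.snd B T M) (by ext; simp)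
  exact ⟨n, (h3.trans (.of_retract f t ht)).trans h2⟩

end Dimensions
end AuslanderGorenstein

namespace AuslanderGorenstein

/-! ### Fitting's lemma, projective covers and injective hulls. -/

section Minimal

variable {B : Type u} [Ring B]
variable {M N P I S : Type u} [AddCommGroup M] [Module B M] [AddCommGroup N] [Module B N]
  [AddCommGroup P] [Module B P] [AddCommGroup I] [Module B I] [AddCommGroup S] [Module B S]

/-- Fitting's lemma. -/
theorem exists_isCompl_pow [IsArtinian B M] [IsNoetherian B M] (φ : Module.End B M) :
    ∃ n : ℕ, IsCompl (LinearMap.ker (φ ^ (n + 1))) (LinearMap.range (φ ^ (n + 1))) := by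
  obtain ⟨n, hn⟩ := Filter.eventually_atTop.1 (LinearMap.eventually_isCompl_ker_pow_range_pow φ)
  -- The exponent is kept positive so that the kernel of the power contains that of `φ` and its
  -- image lies in that of `φ`.
  exact ⟨n, hn (n + 1) (Nat.le_succ n)⟩

theorem exists_retraction {U V : Submodule B M} (h : IsCompl U V) :
    ∃ π : M →ₗ[B] V, π ∘ₗ V.subtype = LinearMap.id :=
  ⟨V.projectionOnto U h.symm, LinearMap.ext fun x => Submodule.projectionOnto_apply_left h.symm x⟩

/-- A retract of `S ⊕ Q` with `Q` projective-injective and without projective-injective summands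
is a retract of `S`. -/
theorem StableRetract.exists_retract [IsArtinian B M] [IsNoetherian B M]
    (h : StableRetract B M S) (hM : NoProjInjSummand B M) :
    ∃ (s : M →ₗ[B] S) (t : S →ₗ[B] M), t ∘ₗ s = LinearMap.id := by
  obtain ⟨Q, s, t, hQ, hst⟩ := h
  let q : M →ₗ[B] Q := LinearMap.snd B S Q ∘ₗ s
  let p : Q →ₗ[B] M := t ∘ₗ LinearMap.inr B S Q
  -- The identity of `M` is the sum of `φ`, which factors through `Q`, and a map factoring through
  -- `S`. The goal is that `φ` is nilpotent.
  let φ : Module.End B M := p ∘ₗ q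
  obtain ⟨n, hn⟩ := exists_isCompl_pow φ
  set V := LinearMap.range (φ ^ (n + 1))
  have hmaps : ∀ x ∈ V, φ x ∈ V := by
    rintro _ ⟨x, rfl⟩
    exact ⟨φ x, by rw [← Module.End.mul_apply, ← pow_succ, pow_succ', Module.End.mul_apply]⟩
  let ψ : V →ₗ[B] V := φ.restrict hmaps
  have hψ : Function.Injective ψ := by
    rw [injective_iff_map_eq_zero]
    rintro ⟨x, hx⟩ hx0
    have h0 : φ x = 0 := congrArg Subtype.val hx0
    have : x ∈ LinearMap.ker (φ ^ (n + 1)) := by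
      rw [LinearMap.mem_ker, pow_succ, Module.End.mul_apply, h0, map_zero]
    exact Subtype.ext ((Submodule.disjoint_def.1 hn.disjoint) x this hx)
  let e := LinearEquiv.ofBijective ψ
    ⟨hψ, IsArtinian.surjective_of_injective_endomorphism ψ hψ⟩
  obtain ⟨π, hπ⟩ := exists_retraction hn
  -- On the Fitting summand `V` the map `φ` is bijective and factors through `Q`, so `V` is a
  -- summand of `Q`. The hypothesis on `M` then forces `V = 0`.
  have hVPI : FPI B V := by
    refine hQ.of_retract (q ∘ₗ V.subtype) (e.symm.toLinearMap ∘ₗ π ∘ₗ p)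
      (LinearMap.ext fun x => ?_)
    change e.symm (π (φ x)) = x
    rw [LinearEquiv.symm_apply_eq]
    exact LinearMap.congr_fun hπ (ψ x)
  have hV0 : V = ⊥ := hM V _ hn.symm hVPI.2
  have hnil : IsNilpotent φ := ⟨n + 1, LinearMap.range_eq_bot.1 hV0⟩
  -- The part through `S` is `1 - φ`, a unit; correcting by its inverse gives a retraction from `S`
  -- alone.
  obtain ⟨u, hu⟩ := hnil.isUnit_one_sub
  refine ⟨LinearMap.fst B S Q ∘ₗ s, (↑u⁻¹ : Module.End B M) ∘ₗ t ∘ₗ LinearMap.inl B S Q, ?_⟩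
  have h1 : (t ∘ₗ LinearMap.inl B S Q) ∘ₗ LinearMap.fst B S Q ∘ₗ s = (u : Module.End B M) := by
    rw [hu]
    refine LinearMap.ext fun x => ?_
    change t ((s x).1, 0) = x - t (0, (s x).2)
    rw [eq_sub_iff_add_eq, ← map_add, Prod.mk_add_mk, add_zero, zero_add]
    exact LinearMap.congr_fun hst x
  rw [LinearMap.comp_assoc, h1]
  exact u.inv_mul

theorem InAdd.of_stableRetract [IsArtinian B M] [IsNoetherian B M] {n : ℕ}
    (h : StableRetract B M (Fin n → S)) (hM : NoProjInjSummand B M) : InAdd B S M := by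
  obtain ⟨s, t, hst⟩ := h.exists_retract hM
  exact ⟨n, s, t, hst⟩

theorem InAdd.inAddPI (h : InAdd B S M) : InAddPI B S M := by
  obtain ⟨n, s, t, hst⟩ := h
  exact inAddPI_iff.2 ⟨n, .of_retract s t hst⟩

theorem InAdd.of_isCompl (h : InAdd B S M) {U V : Submodule B M} (hUV : IsCompl U V) :
    InAdd B S U := by
  obtain ⟨n, s, t, hst⟩ := h
  obtain ⟨π, hπ⟩ := exists_retraction hUV.symm
  refine ⟨n, s ∘ₗ U.subtype, π ∘ₗ t, LinearMap.ext fun x => ?_⟩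
  have h1 : t (s x) = x := LinearMap.congr_fun hst x
  change π (t (s x)) = x
  rw [h1]
  exact LinearMap.congr_fun hπ x

/-- A submodule `U` is superfluous if `N + U = M` implies `N = M`. -/
def Superfluous (U : Submodule B M) : Prop := ∀ N : Submodule B M, N ⊔ U = ⊤ → N = ⊤

theorem Superfluous.map {U : Submodule B M} (h : Superfluous U) (f : M →ₗ[B] N) :
    Superfluous (U.map f) := by
  intro V hV
  have h1 : V.comap f ⊔ U = ⊤ := by
    refine eq_top_iff.2 fun x _ => ?_
    obtain ⟨v, hv, w, ⟨y, hy, rfl⟩, hvw⟩ := Submodule.mem_sup.1 (hV ▸ Submodule.mem_top : f x ∈ _)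
    refine Submodule.mem_sup.2 ⟨x - y, ?_, y, hy, by simp⟩
    rw [Submodule.mem_comap, map_sub, ← hvw, add_sub_cancel_right]
    exact hv
  have h2 : U.map f ≤ V := by
    rw [Submodule.map_le_iff_le_comap, h _ h1]
    exact le_top
  rwa [sup_eq_left.2 h2] at hV

theorem Superfluous.finset_sup {ι : Type*} (s : Finset ι) (U : ι → Submodule B M)
    (h : ∀ i, Superfluous (U i)) : Superfluous (s.sup U) := by
  classical
  induction s using Finset.induction_on with
  | empty => exact fun N hN => by simpa using hN
  | insert i s _ ih =>
    intro N hN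
    rw [Finset.sup_insert, ← sup_assoc] at hN
    exact h i N (ih _ hN)

/-- An injective module in `add(Ω(N))` is zero. -/
theorem subsingleton_of_inAdd_ker {p : P →ₗ[B] N} (hp : IsProjectiveCover p)
    (hM : Module.Injective B M) (h : InAdd B (LinearMap.ker p) M) : Subsingleton M := by
  obtain ⟨n, s, t, hst⟩ := h
  -- Injectivity of `M` extends the components of `t` to the whole cover `P`. Images of the
  -- superfluous kernel are superfluous, yet together they sum to `M`.
  choose T hT using fun i : Fin n => Module.Injective.extend
    (Submodule.subtype_injective (LinearMap.ker p))
    (t ∘ₗ LinearMap.single B (fun _ => LinearMap.ker p) i)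
  have h1 : Superfluous (Finset.univ.sup fun i => (LinearMap.ker p).map (T i)) :=
    .finset_sup _ _ fun i => Superfluous.map hp.superfluous (T i)
  have h2 : (Finset.univ.sup fun i => (LinearMap.ker p).map (T i)) = ⊤ := by
    refine eq_top_iff.2 fun x _ => ?_
    have h3 : x = ∑ i, T i (s x i) := by
      have h4 : ∀ i, T i (s x i) = t (Pi.single i (s x i)) := fun i =>
        LinearMap.congr_fun (hT i) (s x i)
      rw [Finset.sum_congr rfl fun i _ => h4 i, ← map_sum, Finset.univ_sum_single]
      exact (LinearMap.congr_fun hst x).symm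
    rw [h3]
    refine Submodule.sum_mem _ fun i hi => ?_
    exact Finset.le_sup (f := fun i => (LinearMap.ker p).map (T i)) hi ⟨_, (s x i).2, rfl⟩
  have h3 := h1 ⊥ (by rw [h2, bot_sup_eq])
  exact (Submodule.subsingleton_iff B).1 (subsingleton_of_bot_eq_top h3)

/-- A submodule `U` is essential if `N ∩ U = 0` implies `N = 0`. -/
def Essential (U : Submodule B M) : Prop := ∀ N : Submodule B M, N ⊓ U = ⊥ → N = ⊥

theorem Essential.comap {U : Submodule B N} (h : Essential U) (f : M →ₗ[B] N) :
    Essential (U.comap f) := by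
  intro V hV
  have h1 : V.map f ⊓ U = ⊥ := by
    refine eq_bot_iff.2 ?_
    rintro _ ⟨⟨x, hx, rfl⟩, hxU⟩
    have : x ∈ V ⊓ U.comap f := ⟨hx, hxU⟩
    rw [hV, Submodule.mem_bot] at this
    simp [this]
  have h2 : V ≤ U.comap f := by
    rw [← Submodule.map_le_iff_le_comap, h _ h1]
    exact bot_le
  rwa [inf_eq_left.2 h2] at hV

theorem Essential.finset_inf {ι : Type*} (s : Finset ι) (U : ι → Submodule B M)
    (h : ∀ i, Essential (U i)) : Essential (s.inf U) := by
  classical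
  induction s using Finset.induction_on with
  | empty => exact fun N hN => by simpa using hN
  | insert i s _ ih =>
    intro N hN
    rw [Finset.inf_insert, ← inf_assoc] at hN
    exact h i N (ih _ hN)

/-- A projective module in `add(Ω⁻¹(N))` is zero. -/
theorem subsingleton_of_inAdd_quot {f : N →ₗ[B] I} (hf : IsInjectiveHull f)
    (hM : Module.Projective B M) (h : InAdd B (I ⧸ LinearMap.range f) M) : Subsingleton M := by
  obtain ⟨n, s, t, hst⟩ := h
  -- Dually, the components of `s` lift to the hull `I`. The preimages of the essential image of `f`
  -- are essential in `M`, yet their intersection is zero.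
  choose σ hσ using fun i : Fin n => Module.projective_lifting_property
    (LinearMap.range f).mkQ (LinearMap.proj i ∘ₗ s) (Submodule.mkQ_surjective _)
  have h1 : Essential (Finset.univ.inf fun i => (LinearMap.range f).comap (σ i)) :=
    .finset_inf _ _ fun i => Essential.comap hf.essential (σ i)
  have h2 : (Finset.univ.inf fun i => (LinearMap.range f).comap (σ i)) = ⊥ := by
    refine eq_bot_iff.2 fun x hx => ?_
    have h3 : s x = 0 := by
      refine funext fun i => ?_
      have h4 : s x i = (LinearMap.range f).mkQ (σ i x) := (LinearMap.congr_fun (hσ i) x).symm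
      rw [h4]
      have h5 := Finset.inf_le (f := fun i => (LinearMap.range f).comap (σ i))
        (Finset.mem_univ i) hx
      exact (Submodule.Quotient.mk_eq_zero _).2 h5
    have h4 : t (s x) = x := LinearMap.congr_fun hst x
    rw [Submodule.mem_bot, ← h4, h3, map_zero]
  have h3 := h1 ⊤ (by rw [h2, inf_bot_eq])
  exact (Submodule.subsingleton_iff B).1 (subsingleton_of_bot_eq_top h3.symm)

/-- Take a minimal projective submodule `U` of a free module still mapping onto `M`. If `N` and the
kernel span `U`, lifting gives an endomorphism of `U` over `M` with values in `N`. Its Fitting image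
is projective, maps onto `M` and lies in `N`, so minimality gives `N = U`. -/
theorem exists_isProjectiveCover [IsArtinianRing B] [Module.Finite B M] :
    ∃ (P : ModuleCat.{u} B) (p : P →ₗ[B] M), IsProjectiveCover p := by
  obtain ⟨n, p, hp⟩ := Module.Finite.exists_fin' B M
  obtain ⟨U, ⟨hU1, hU2⟩, hmin⟩ := IsArtinian.set_has_minimal
    {U : Submodule B (Fin n → B) | Module.Projective B U ∧ Function.Surjective (p ∘ₗ U.subtype)}
    ⟨⊤, .of_equiv Submodule.topEquiv.symm, fun x => by
      obtain ⟨y, hy⟩ := hp x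
      exact ⟨⟨y, trivial⟩, hy⟩⟩
  refine ⟨.of B U, p ∘ₗ U.subtype, hU1, hU2, fun N hN => ?_⟩
  have hN' : Function.Surjective ((p ∘ₗ U.subtype) ∘ₗ N.subtype) := by
    intro x
    obtain ⟨y, hy⟩ := hU2 x
    obtain ⟨v, hv, w, hw, hvw⟩ := Submodule.mem_sup.1 (hN ▸ Submodule.mem_top : y ∈ _)
    refine ⟨⟨v, hv⟩, ?_⟩
    rw [← hy, ← hvw, map_add, LinearMap.mem_ker.1 hw, add_zero]
    rfl
  obtain ⟨g, hg⟩ := Module.projective_lifting_property _ (p ∘ₗ U.subtype) hN'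
  let φ : Module.End B U := N.subtype ∘ₗ g
  have hφ : ∀ x, p (φ x : U) = p x := LinearMap.congr_fun hg
  obtain ⟨k, hk⟩ := exists_isCompl_pow φ
  set V := LinearMap.range (φ ^ (k + 1))
  have hpow : ∀ m : ℕ, ∀ x, p ((φ ^ m) x : U) = p x := by
    intro m
    induction m with
    | zero => exact fun x => rfl
    | succ m ih =>
      intro x
      rw [pow_succ', Module.End.mul_apply, hφ, ih]
  obtain ⟨π, hπ⟩ := exists_retraction hk
  have hV : Module.Projective B V := .of_split V.subtype π hπ
  have hVN : V ≤ N := by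
    rintro _ ⟨x, rfl⟩
    rw [pow_succ', Module.End.mul_apply]
    exact (g _).2
  have hmem : V.map U.subtype ∈ {U : Submodule B (Fin n → B) |
      Module.Projective B U ∧ Function.Surjective (p ∘ₗ U.subtype)} := by
    refine ⟨.of_equiv (V.equivMapOfInjective U.subtype U.subtype_injective), fun x => ?_⟩
    obtain ⟨y, hy⟩ := hU2 x
    refine ⟨⟨((φ ^ (k + 1)) y : U), ⟨_, ⟨y, rfl⟩, rfl⟩⟩, ?_⟩
    exact (hpow _ y).trans hy
  have h1 : V.map U.subtype = U :=
    (eq_or_lt_of_le (Submodule.map_subtype_le U V)).resolve_right (hmin _ hmem)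
  refine eq_top_iff.2 fun x _ => hVN ?_
  have h2 : (x : Fin n → B) ∈ V.map U.subtype := h1.symm ▸ x.2
  obtain ⟨y, hy, hyx⟩ := h2
  rwa [← Subtype.ext hyx]

/-- Every finitely generated module embeds into a finitely generated injective module. -/
def EnoughFiniteInjectives (B : Type u) [Ring B] : Prop :=
  ∀ (M : Type u) [AddCommGroup M] [Module B M], Module.Finite B M →
    ∃ (I : ModuleCat.{u} B) (f : M →ₗ[B] I), Module.Finite B I ∧ Module.Injective B I ∧
      Function.Injective f

/-- Take a minimal injective submodule `U` containing `M`. If `N` meets `M` trivially, an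
endomorphism of `U` fixes `M` and factors through `U / N`. Its Fitting image is injective and
contains `M`, hence is `U`; so a power of it is injective while killing `N`. -/
theorem EnoughFiniteInjectives.exists_isInjectiveHull [IsArtinianRing B]
    (hB : EnoughFiniteInjectives B) [hM : Module.Finite B M] :
    ∃ (I : ModuleCat.{u} B) (f : M →ₗ[B] I), IsInjectiveHull f := by
  obtain ⟨I, f, hI, hinj, hf⟩ := hB M hM
  obtain ⟨U, ⟨hU1, hU2⟩, hmin⟩ := IsArtinian.set_has_minimal
    {U : Submodule B I | Module.Injective B U ∧ LinearMap.range f ≤ U}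
    ⟨⊤, .of_retract Submodule.topEquiv.toLinearMap Submodule.topEquiv.symm.toLinearMap
      (by ext; simp), le_top⟩
  let f' : M →ₗ[B] U := f.codRestrict U fun x => hU2 ⟨x, rfl⟩
  have hf' : Function.Injective f' := fun x y h => hf (congrArg Subtype.val h)
  refine ⟨.of B U, f', hU1, hf', fun N hN => ?_⟩
  have hinj' : Function.Injective (N.mkQ ∘ₗ f') := by
    rw [injective_iff_map_eq_zero]
    intro x hx
    have : f' x ∈ N ⊓ LinearMap.range f' := ⟨(Submodule.Quotient.mk_eq_zero N).1 hx, x, rfl⟩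
    rw [hN, Submodule.mem_bot] at this
    exact hf' (this.trans (map_zero f').symm)
  obtain ⟨g, hg⟩ := Module.Injective.extend hinj' f'
  let φ : Module.End B U := g ∘ₗ N.mkQ
  have hφ : ∀ x, φ (f' x) = f' x := LinearMap.congr_fun hg
  obtain ⟨k, hk⟩ := exists_isCompl_pow φ
  set V := LinearMap.range (φ ^ (k + 1))
  have hpow : ∀ m : ℕ, ∀ x, (φ ^ m) (f' x) = f' x := by
    intro m
    induction m with
    | zero => exact fun x => rfl
    | succ m ih =>
      intro x
      rw [pow_succ', Module.End.mul_apply, ih, hφ]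
  obtain ⟨π, hπ⟩ := exists_retraction hk
  have hV : Module.Injective B V := .of_retract V.subtype π hπ
  let e := V.equivMapOfInjective U.subtype U.subtype_injective
  have hmem : V.map U.subtype ∈
      {U : Submodule B I | Module.Injective B U ∧ LinearMap.range f ≤ U} := by
    refine ⟨.of_retract e.symm.toLinearMap e.toLinearMap (by ext; simp), ?_⟩
    rintro _ ⟨x, rfl⟩
    exact ⟨f' x, ⟨f' x, hpow _ x⟩, rfl⟩
  have h1 : V.map U.subtype = U :=
    (eq_or_lt_of_le (Submodule.map_subtype_le U V)).resolve_right (hmin _ hmem)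
  have hVtop : V = ⊤ := by
    refine eq_top_iff.2 fun x _ => ?_
    have h2 : (x : I) ∈ V.map U.subtype := h1.symm ▸ x.2
    obtain ⟨y, hy, hyx⟩ := h2
    rwa [← Subtype.ext hyx]
  have hker : LinearMap.ker (φ ^ (k + 1)) = ⊥ := by
    have := hk.disjoint
    rwa [hVtop, disjoint_top] at this
  refine eq_bot_iff.2 fun x hx => ?_
  rw [← hker, LinearMap.mem_ker, pow_succ, Module.End.mul_apply]
  have : φ x = 0 := by
    change g (N.mkQ x) = 0
    rw [Submodule.mkQ_apply, (Submodule.Quotient.mk_eq_zero N).2 hx, map_zero]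
  rw [this, map_zero]

/-! ### Minimal resolutions compared with arbitrary ones. -/

theorem IsInjectiveHull.isSES {f : M →ₗ[B] I} (hf : IsInjectiveHull f) :
    IsSES f (LinearMap.range f).mkQ := isSES_mkQ hf.injective

theorem IsProjectiveCover.isSES {p : P →ₗ[B] M} (hp : IsProjectiveCover p) :
    IsSES (LinearMap.ker p).subtype p := isSES_ker hp.surjective

theorem IsInjectiveHull.injective_of_comp {f : M →ₗ[B] I} (hf : IsInjectiveHull f)
    (j : I →ₗ[B] N) (hj : Function.Injective (j ∘ₗ f)) : Function.Injective j := by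
  rw [← LinearMap.ker_eq_bot]
  refine hf.essential _ (eq_bot_iff.2 ?_)
  rintro _ ⟨hx, x, rfl⟩
  have : x = 0 := hj (hx.trans (map_zero (j ∘ₗ f)).symm)
  simp [this]

theorem IsInjectiveHull.finite [IsNoetherianRing B] (hB : EnoughFiniteInjectives B)
    [hM : Module.Finite B M] {f : M →ₗ[B] I} (hf : IsInjectiveHull f) : Module.Finite B I := by
  obtain ⟨J, g, hJ, hJinj, hg⟩ := hB M hM
  obtain ⟨j, rfl⟩ := Module.Injective.extend hf.injective g
  exact Module.Finite.of_injective j (hf.injective_of_comp j hg)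

theorem IsProjectiveCover.surjective_of_comp {p : P →ₗ[B] M} (hp : IsProjectiveCover p)
    (j : N →ₗ[B] P) (hj : Function.Surjective (p ∘ₗ j)) : Function.Surjective j := by
  rw [← LinearMap.range_eq_top]
  refine hp.superfluous _ (eq_top_iff.2 fun x _ => ?_)
  obtain ⟨y, hy⟩ := hj (p x)
  exact Submodule.mem_sup.2 ⟨j y, ⟨y, rfl⟩, x - j y,
    by rw [LinearMap.mem_ker, map_sub, ← hy]; exact sub_self _, by simp⟩

theorem IsProjectiveCover.finite [Module.Finite B M] {p : P →ₗ[B] M}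
    (hp : IsProjectiveCover p) : Module.Finite B P := by
  obtain ⟨n, q, hq⟩ := Module.Finite.exists_fin' B M
  obtain ⟨j, rfl⟩ := Module.projective_lifting_property p q hp.surjective
  exact Module.Finite.of_surjective j (hp.surjective_of_comp j hq)

/-- The hull is a summand of every injective module into which `M` embeds, so it is
projective-injective as soon as one such embedding exists. The two cokernels then agree up to
projective-injective summands. -/
theorem IsInjectiveHull.fpi {n : ℕ} {f : M →ₗ[B] I} (hf : IsInjectiveHull f)
    (h : DomGE B (n + 1) M) : FPI B I ∧ DomGE B n (I ⧸ LinearMap.range f) := by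
  obtain ⟨Q, C, a, b, h1, h2, h3⟩ := domGE_succ.1 h
  have := h2.2.2
  obtain ⟨j, rfl⟩ := Module.Injective.extend hf.injective a
  obtain ⟨⟨t, ht⟩, -⟩ := (isSES_mkQ (hf.injective_of_comp j h1.inj)).split_of_injective
    hf.injective_module
  have hI := h2.of_retract j t ht
  exact ⟨hI, h3.of_stableRetract (StableRetract.refl.cokernel hf.isSES hI h1 h2.2.2)⟩

theorem IsProjectiveCover.fpi {n : ℕ} {p : P →ₗ[B] M} (hp : IsProjectiveCover p)
    (h : CoGE B (n + 1) M) : FPI B P ∧ CoGE B n (LinearMap.ker p) := by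
  obtain ⟨K, Q, a, b, h1, h2, h3⟩ := coGE_succ.1 h
  have := h2.2.1
  obtain ⟨j, rfl⟩ := Module.projective_lifting_property p b hp.surjective
  obtain ⟨-, s, hs⟩ := (isSES_ker (hp.surjective_of_comp j h1.surj)).split_of_projective
    hp.projective
  have hP := h2.of_retract s j hs
  exact ⟨hP, h3.of_stableRetract (StableRetract.refl.kernel hp.isSES hP h1 h2.2.1)⟩

theorem domDimGE_iff [IsArtinianRing B] (hB : EnoughFiniteInjectives B) {n : ℕ} :
    ∀ {M : Type u} [AddCommGroup M] [Module B M] [Module.Finite B M],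
      DomDimGE B n M ↔ DomGE B n M := by
  induction n with
  | zero => exact fun {_} _ _ _ => ⟨fun _ => .zero, fun _ => trivial⟩
  | succ n ih =>
    intro M _ _ _
    constructor
    · rintro ⟨I, _, _, f, hf, hI, h⟩
      have := hf.finite hB
      exact domGE_succ.2 ⟨.of B I, .of B _, f, _, hf.isSES, ⟨this, hI, hf.injective_module⟩,
        ih.1 h⟩
    · intro h
      obtain ⟨I, f, hf⟩ := hB.exists_isInjectiveHull (M := M)
      obtain ⟨h1, h2⟩ := hf.fpi h
      have := h1.1
      exact ⟨I, _, _, f, hf, h1.2.1, ih.2 h2⟩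

theorem domDim_eq_iff [IsArtinianRing B] (hB : EnoughFiniteInjectives B) [Module.Finite B M]
    {n : ℕ} : domDim B M = n ↔ DomGE B n M ∧ ¬ DomGE B (n + 1) M := by
  have hle : ∀ m : ℕ, DomGE B m M → (m : ℕ∞) ≤ domDim B M := fun m hm =>
    le_iSup₂_of_le m ((domDimGE_iff hB).2 hm) le_rfl
  constructor
  · intro h
    have hnot : ∀ m : ℕ, n < m → ¬ DomGE B m M := fun m hm hd => by
      have := hle m hd
      rw [h, Nat.cast_le] at this
      lia
    refine ⟨?_, hnot _ (Nat.lt_succ_self n)⟩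
    by_contra hn
    have h1 : ∀ m : ℕ, DomGE B m M → m < n := fun m hm => by
      by_contra hmn
      exact hn (hm.mono (not_lt.1 hmn))
    have h2 : 0 < n := h1 0 .zero
    -- The supremum is attained: if `DomGE` fails at `n`, all admissible values are at most `n - 1`,
    -- with `n > 0` since 0 is always admissible.
    have h3 : domDim B M ≤ ((n - 1 : ℕ) : ℕ∞) := by
      refine iSup₂_le fun m hm => ?_
      have := h1 m ((domDimGE_iff hB).1 hm)
      exact Nat.cast_le.2 (by lia)
    rw [h, Nat.cast_le] at h3
    lia
  · rintro ⟨h1, h2⟩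
    refine le_antisymm (iSup₂_le fun m hm => ?_) (hle n h1)
    have h3 := (domDimGE_iff hB).1 hm
    refine Nat.cast_le.2 ?_
    by_contra hmn
    exact h2 (h3.mono (not_le.1 hmn))

theorem exists_isSyzygy [IsArtinianRing B] (n : ℕ) :
    ∀ (M : Type u) [AddCommGroup M] [Module B M] [Module.Finite B M],
      ∃ S : ModuleCat.{u} B, IsSyzygy B n M S := by
  induction n with
  | zero => exact fun M _ _ _ => ⟨.of B M, ⟨.refl B M⟩⟩
  | succ n ih =>
    intro M _ _ _
    obtain ⟨P, p, hp⟩ := exists_isProjectiveCover (B := B) (M := M)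
    have := hp.finite
    obtain ⟨S, hS⟩ := ih (LinearMap.ker p)
    exact ⟨S, P, _, _, p, hp, hS⟩

theorem EnoughFiniteInjectives.exists_isCosyzygy [IsArtinianRing B]
    (hB : EnoughFiniteInjectives B) (n : ℕ) :
    ∀ (M : Type u) [AddCommGroup M] [Module B M] [Module.Finite B M],
      ∃ S : ModuleCat.{u} B, IsCosyzygy B n M S := by
  induction n with
  | zero => exact fun M _ _ _ => ⟨.of B M, ⟨.refl B M⟩⟩
  | succ n ih =>
    intro M _ _ _
    obtain ⟨I, f, hf⟩ := hB.exists_isInjectiveHull (M := M)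
    have := hf.finite hB
    obtain ⟨S, hS⟩ := ih (I ⧸ LinearMap.range f)
    exact ⟨S, I, _, _, f, hf, hS⟩

/-- Up to the codominant dimension the projective covers in the minimal resolution are themselves
projective-injective. -/
theorem chain_of_isSyzygy {n : ℕ} {S : Type u} [AddCommGroup S] [Module B S] :
    ∀ {M : Type u} [AddCommGroup M] [Module B M], CoGE B n M → IsSyzygy B n M S →
      CoChain B n S M := by
  induction n with
  | zero => exact fun _ h => h
  | succ n ih =>
    rintro M _ _ h ⟨P, _, _, p, hp, hS⟩
    obtain ⟨h1, h2⟩ := hp.fpi h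
    exact ⟨.of B _, .of B P, _, p, hp.isSES, h1, ih h2 hS⟩

theorem chain_of_isCosyzygy {n : ℕ} {S : Type u} [AddCommGroup S] [Module B S] :
    ∀ {M : Type u} [AddCommGroup M] [Module B M], DomGE B n M → IsCosyzygy B n M S →
      Chain B n M S := by
  induction n with
  | zero => exact fun _ ⟨e⟩ => ⟨e.symm⟩
  | succ n ih =>
    rintro M _ _ h ⟨I, _, _, f, hf, hS⟩
    obtain ⟨h1, h2⟩ := hf.fpi h
    exact ⟨.of B I, .of B _, f, _, hf.isSES, h1, ih h2 hS⟩

/-- An injective module in `add(Ω^n(N))` with `n ≥ 1` is zero. -/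
theorem subsingleton_of_inAdd_syzygy {n : ℕ} {S : Type u} [AddCommGroup S] [Module B S]
    (hM : Module.Injective B M) (h : InAdd B S M) :
    ∀ {N : Type u} [AddCommGroup N] [Module B N], IsSyzygy B (n + 1) N S → Subsingleton M := by
  induction n with
  | zero =>
    rintro N _ _ ⟨P, _, _, p, hp, ⟨e⟩⟩
    obtain ⟨m, s, t, hst⟩ := h
    refine subsingleton_of_inAdd_ker hp hM ⟨m, e.toLinearMap.compLeft (Fin m) ∘ₗ s,
      t ∘ₗ e.symm.toLinearMap.compLeft (Fin m), LinearMap.ext fun x => ?_⟩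
    have : e.symm.toLinearMap.compLeft (Fin m) (e.toLinearMap.compLeft (Fin m) (s x)) = s x :=
      funext fun i => e.symm_apply_apply _
    change t (e.symm.toLinearMap.compLeft (Fin m) (e.toLinearMap.compLeft (Fin m) (s x))) = x
    rw [this]
    exact LinearMap.congr_fun hst x
  | succ n ih =>
    rintro N _ _ ⟨P, _, _, p, hp, h'⟩
    exact ih h'

/-- A projective module in `add(Ω^{-n}(N))` with `n ≥ 1` is zero. -/
theorem subsingleton_of_inAdd_cosyzygy {n : ℕ} {S : Type u} [AddCommGroup S] [Module B S]
    (hM : Module.Projective B M) (h : InAdd B S M) :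
    ∀ {N : Type u} [AddCommGroup N] [Module B N], IsCosyzygy B (n + 1) N S → Subsingleton M := by
  induction n with
  | zero =>
    rintro N _ _ ⟨P, _, _, p, hp, ⟨e⟩⟩
    obtain ⟨m, s, t, hst⟩ := h
    refine subsingleton_of_inAdd_quot hp hM ⟨m, e.toLinearMap.compLeft (Fin m) ∘ₗ s,
      t ∘ₗ e.symm.toLinearMap.compLeft (Fin m), LinearMap.ext fun x => ?_⟩
    have : e.symm.toLinearMap.compLeft (Fin m) (e.toLinearMap.compLeft (Fin m) (s x)) = s x :=
      funext fun i => e.symm_apply_apply _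
    change t (e.symm.toLinearMap.compLeft (Fin m) (e.toLinearMap.compLeft (Fin m) (s x))) = x
    rw [this]
    exact LinearMap.congr_fun hst x
  | succ n ih =>
    rintro N _ _ ⟨P, _, _, p, hp, h'⟩
    exact ih h'

end Minimal
end AuslanderGorenstein

namespace AuslanderGorenstein

/-! ### Duality over the ground field, expressed by perfect pairings. -/

section Duality

variable {K : Type u} [Field K] {B B' : Type u} [Ring B] [Ring B'] [Algebra K B] [Algebra K B']

/-- A perfect `K`-bilinear pairing between a `B`-module `M` and a `B'`-module `N`, balanced with
respect to an identification of `B` with the opposite of `B'`. It exhibits each of the two modules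
as the `K`-dual of the other. -/
structure IsDualPairing (e : B ≃ₐ[K] B'ᵐᵒᵖ) {M N : Type u} [AddCommGroup M] [Module B M]
    [AddCommGroup N] [Module B' N] (β : M →+ N →+ K) : Prop where
  smul_left : ∀ k m n, β (algebraMap K B k • m) n = k * β m n
  adj : ∀ b m n, β (b • m) n = β m ((e b).unop • n)
  left_surj : ∀ ψ : M →+ K, (∀ k m, ψ (algebraMap K B k • m) = k * ψ m) → ∃ n, ∀ m, β m n = ψ m
  right_surj : ∀ ψ : N →+ K, (∀ k n, ψ (algebraMap K B' k • n) = k * ψ n) → ∃ m, ∀ n, β m n = ψ n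
  sep_left : ∀ m, (∀ n, β m n = 0) → m = 0
  sep_right : ∀ n, (∀ m, β m n = 0) → n = 0

/-- The identification of `B'` with the opposite of `B` coming from one of `B` with the opposite
of `B'`. -/
def flipEquiv (e : B ≃ₐ[K] B'ᵐᵒᵖ) : B' ≃ₐ[K] Bᵐᵒᵖ := (AlgEquiv.opComm e).symm

variable (e : B ≃ₐ[K] B'ᵐᵒᵖ)

theorem flipEquiv_unop (b' : B') : (flipEquiv e b').unop = e.symm (MulOpposite.op b') := rfl

theorem flipEquiv_flipEquiv : flipEquiv (flipEquiv e) = e := by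
  ext b
  refine MulOpposite.unop_injective ?_
  rw [flipEquiv_unop, AlgEquiv.symm_apply_eq]
  refine MulOpposite.unop_injective ?_
  rw [flipEquiv_unop]
  simp

theorem unop_algebraMap (k : K) : (e (algebraMap K B k)).unop = algebraMap K B' k := by
  rw [e.commutes]
  rfl

variable {M N M' N' M'' N'' : Type u} [AddCommGroup M] [Module B M] [AddCommGroup N] [Module B' N]
  [AddCommGroup M'] [Module B M'] [AddCommGroup N'] [Module B' N']
  [AddCommGroup M''] [Module B M''] [AddCommGroup N''] [Module B' N'']

variable {e}

section Pairing

variable {β : M →+ N →+ K} {β' : M' →+ N' →+ K} {β'' : M'' →+ N'' →+ K}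

theorem IsDualPairing.smul_right (h : IsDualPairing e β) (k : K) (m : M) (n : N) :
    β m (algebraMap K B' k • n) = k * β m n := by
  rw [← h.smul_left, h.adj, unop_algebraMap]

theorem IsDualPairing.adj' (h : IsDualPairing e β) (b' : B') (m : M) (n : N) :
    β m (b' • n) = β (e.symm (MulOpposite.op b') • m) n := by
  rw [h.adj, e.apply_symm_apply, MulOpposite.unop_op]

/-- The notion is symmetric in the two sides, so each statement about duals also yields its mirror
image without a separate bidual. -/
theorem IsDualPairing.flip (h : IsDualPairing e β) : IsDualPairing (flipEquiv e) β.flip where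
  smul_left k n m := h.smul_right k m n
  adj b' n m := h.adj' b' m n
  left_surj := h.right_surj
  right_surj := h.left_surj
  sep_left := h.sep_right
  sep_right := h.sep_left

theorem IsDualPairing.ext_right (h : IsDualPairing e β) {n n' : N}
    (hn : ∀ m, β m n = β m n') : n = n' :=
  sub_eq_zero.1 (h.sep_right _ fun m => by rw [map_sub, hn, sub_self])

theorem IsDualPairing.exists_transpose (h : IsDualPairing e β) (h' : IsDualPairing e β')
    (f : M →ₗ[B] M') : ∃ g : N' →ₗ[B'] N, ∀ m n', β m (g n') = β' (f m) n' := by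
  choose g hg using fun n' : N' => h.left_surj ((β'.flip n').comp f.toAddMonoidHom)
    (fun k m => by simp [h'.smul_left])
  replace hg : ∀ n' m, β m (g n') = β' (f m) n' := hg
  exact ⟨{
    toFun := g
    map_add' := fun x y => h.ext_right fun m => by simp [hg]
    map_smul' := fun b' x => h.ext_right fun m => by
      simp [hg, h.adj', h'.adj'] }, fun m n' => hg n' m⟩

end Pairing

/-- Only `K`-linearity is asked of the functionals, and over a field an injection has a linear left
inverse. -/
theorem exists_extension_of_injective {f : M →ₗ[B] M'} (hf : Function.Injective f) (ψ : M →+ K)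
    (hψ : ∀ k m, ψ (algebraMap K B k • m) = k * ψ m) :
    ∃ ψ' : M' →+ K, (∀ k m, ψ' (algebraMap K B k • m) = k * ψ' m) ∧ ∀ m, ψ' (f m) = ψ m := by
  let _ : Module K M := Module.compHom M (algebraMap K B)
  let _ : Module K M' := Module.compHom M' (algebraMap K B)
  let fK : M →ₗ[K] M' := { f with map_smul' := fun k m => f.map_smul (algebraMap K B k) m }
  let ψK : M →ₗ[K] K := { ψ with map_smul' := hψ }
  obtain ⟨r, hr⟩ := fK.exists_leftInverse_of_injective (LinearMap.ker_eq_bot.2 hf)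
  refine ⟨(ψK ∘ₗ r).toAddMonoidHom, fun k m => (ψK ∘ₗ r).map_smul k m, fun m => ?_⟩
  exact congrArg ψ (LinearMap.congr_fun hr m)

section Pairing

variable {β : M →+ N →+ K} {β' : M' →+ N' →+ K} {β'' : M'' →+ N'' →+ K}

theorem IsDualPairing.surjective_transpose (h : IsDualPairing e β) (h' : IsDualPairing e β')
    {f : M →ₗ[B] M'} {g : N' →ₗ[B'] N} (hfg : ∀ m n', β m (g n') = β' (f m) n')
    (hf : Function.Injective f) : Function.Surjective g := by
  intro n
  obtain ⟨ψ, hψ, hψ'⟩ := exists_extension_of_injective hf (β.flip n) fun k m => h.smul_left k m n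
  obtain ⟨n', hn'⟩ := h'.left_surj ψ hψ
  refine ⟨n', h.ext_right fun m => ?_⟩
  rw [hfg, hn', hψ']
  rfl

theorem IsDualPairing.injective_transpose (h' : IsDualPairing e β')
    {f : M →ₗ[B] M'} {g : N' →ₗ[B'] N} (hfg : ∀ m n', β m (g n') = β' (f m) n')
    (hf : Function.Surjective f) : Function.Injective g := by
  rw [injective_iff_map_eq_zero]
  intro n' hn'
  refine h'.sep_right _ fun m' => ?_
  obtain ⟨m, rfl⟩ := hf m'
  rw [← hfg, hn', map_zero]

theorem IsSES.exists_dual (h : IsDualPairing e β) (h' : IsDualPairing e β')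
    (h'' : IsDualPairing e β'') {f : M →ₗ[B] M'} {g : M' →ₗ[B] M''} (hfg : IsSES f g) :
    ∃ (g' : N'' →ₗ[B'] N') (f' : N' →ₗ[B'] N), IsSES g' f' := by
  obtain ⟨f', hf'⟩ := h.exists_transpose h' f
  obtain ⟨g', hg'⟩ := h'.exists_transpose h'' g
  refine ⟨g', f', h''.injective_transpose hg' hfg.surj, h.surjective_transpose h' hf' hfg.inj,
    fun n' => ⟨fun hn' => ?_, ?_⟩⟩
  · have hker : ∀ m', g m' = 0 → β' m' n' = 0 := by
      intro m' hm'
      obtain ⟨m, rfl⟩ := (hfg.exact m').1 hm'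
      rw [← hf', hn', map_zero]
    -- A functional vanishing on the kernel of `g` descends to `M''`; its value is read off on
    -- arbitrary preimages.
    choose σ hσ using hfg.surj
    have hwd : ∀ x y, g x = g y → β' x n' = β' y n' := fun x y hxy => by
      have := hker (x - y) (by rw [map_sub, hxy, sub_self])
      rwa [map_sub, AddMonoidHom.sub_apply, sub_eq_zero] at this
    let ψ : M'' →+ K := {
      toFun := fun m => β' (σ m) n'
      map_zero' := hker _ (hσ 0)
      map_add' := fun x y => by
        rw [← AddMonoidHom.add_apply, ← map_add]
        exact hwd _ _ (by simp [hσ]) }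
    obtain ⟨n'', hn''⟩ := h''.left_surj ψ fun k m => by
      change β' (σ _) n' = k * β' (σ m) n'
      rw [← h'.smul_left]
      exact hwd _ _ (by simp [hσ])
    refine ⟨n'', h'.ext_right fun m' => ?_⟩
    rw [hg', hn'']
    exact hwd _ _ (hσ _)
  · rintro ⟨n'', rfl⟩
    refine h.sep_right _ fun m => ?_
    rw [hf', hg', hfg.exact.apply_apply_eq_zero]
    simp

theorem IsDualPairing.pi (h : IsDualPairing e β) (n : ℕ) :
    ∃ γ : (Fin n → M) →+ (Fin n → N) →+ K, IsDualPairing e γ := by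
  classical
  let γ : (Fin n → M) →+ (Fin n → N) →+ K := AddMonoidHom.mk'
    (fun x => AddMonoidHom.mk' (fun y => ∑ i, β (x i) (y i))
      fun y y' => by simp [Finset.sum_add_distrib])
    fun x x' => by ext y; simp [Finset.sum_add_distrib]
  have hγ : ∀ x y, γ x y = ∑ i, β (x i) (y i) := fun x y => rfl
  refine ⟨γ, ⟨fun k x y => ?_, fun b x y => ?_, fun ψ hψ => ?_, fun ψ hψ => ?_,
    fun x hx => ?_, fun y hy => ?_⟩⟩
  · simp [hγ, h.smul_left, Finset.mul_sum]
  · simp [hγ, h.adj]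
  · choose y hy using fun i => h.left_surj (ψ.comp (AddMonoidHom.single (fun _ => M) i))
      fun k m => by
        have := hψ k (Pi.single i m)
        rwa [← Pi.single_smul] at this
    refine ⟨y, fun x => ?_⟩
    rw [hγ, Finset.sum_congr rfl fun i _ => hy i (x i)]
    simp only [AddMonoidHom.comp_apply, AddMonoidHom.single_apply]
    rw [← map_sum, Finset.univ_sum_single]
  · choose y hy using fun i => h.right_surj (ψ.comp (AddMonoidHom.single (fun _ => N) i))
      fun k m => by
        have := hψ k (Pi.single i m)
        rwa [← Pi.single_smul] at this
    refine ⟨y, fun x => ?_⟩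
    rw [hγ, Finset.sum_congr rfl fun i _ => hy i (x i)]
    simp only [AddMonoidHom.comp_apply, AddMonoidHom.single_apply]
    rw [← map_sum, Finset.univ_sum_single]
  · refine funext fun i => h.sep_left _ fun n => ?_
    have := hx (Pi.single i n)
    rw [hγ, Finset.sum_eq_single i (fun j _ hj => by simp [hj]) (by simp)] at this
    simpa using this
  · refine funext fun i => h.sep_right _ fun n => ?_
    have := hy (Pi.single i n)
    rw [hγ, Finset.sum_eq_single i (fun j _ hj => by simp [hj]) (by simp)] at this
    simpa using this

theorem IsDualPairing.finite_right [FiniteDimensional K B] [Module.Finite B M]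
    (h : IsDualPairing e β) : Module.Finite B' N := by
  let _ : Module K M := Module.compHom M (algebraMap K B)
  let _ : Module K N := Module.compHom N (algebraMap K B')
  have : IsScalarTower K B M := ⟨fun k b m => by rw [Algebra.smul_def, mul_smul]; rfl⟩
  have : IsScalarTower K B' N := ⟨fun k b m => by rw [Algebra.smul_def, mul_smul]; rfl⟩
  have : FiniteDimensional K M := Module.Finite.trans B M
  let f : N →ₗ[K] Module.Dual K M := {
    toFun := fun n => { β.flip n with map_smul' := fun k m => h.smul_left k m n }
    map_add' := fun n n' => LinearMap.ext fun m => map_add (β m) n n'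
    map_smul' := fun k n => LinearMap.ext fun m => h.smul_right k m n }
  have hf : Function.Injective f := fun n n' hn =>
    h.ext_right fun m => LinearMap.congr_fun hn m
  have : FiniteDimensional K N := Module.Finite.of_injective f hf
  exact Module.Finite.of_restrictScalars_finite K B' N

theorem IsDualPairing.finite_left [FiniteDimensional K B'] [Module.Finite B' N]
    (h : IsDualPairing e β) : Module.Finite B M := h.flip.finite_right

end Pairing

/-- The `K`-dual of a `B'`-module, as a `B`-module. -/
def twistedDual (_e : B ≃ₐ[K] B'ᵐᵒᵖ) (X : Type u) [AddCommGroup X] [Module B' X] :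
    AddSubgroup (X →+ K) where
  carrier := {ψ | ∀ k x, ψ (algebraMap K B' k • x) = k * ψ x}
  add_mem' h h' k x := by simp [h k x, h' k x, mul_add]
  zero_mem' k x := by simp
  neg_mem' h k x := by simp [h k x]

/-- The dual of a `B'`-module is a `B`-module. -/
instance twistedDualModule (X : Type u) [AddCommGroup X] [Module B' X] :
    Module B (twistedDual e X) where
  smul b ψ := ⟨ψ.1.comp (DistribSMul.toAddMonoidHom X (e b).unop), fun k x => by
    change ψ.1 ((e b).unop • algebraMap K B' k • x) = k * ψ.1 ((e b).unop • x)
    rw [← ψ.2, ← mul_smul, ← mul_smul, Algebra.commutes]⟩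
  one_smul ψ := Subtype.ext (AddMonoidHom.ext fun x => by
    change ψ.1 ((e 1).unop • x) = ψ.1 x
    rw [map_one, MulOpposite.unop_one, one_smul])
  mul_smul b c ψ := Subtype.ext (AddMonoidHom.ext fun x => by
    change ψ.1 ((e (b * c)).unop • x) = ψ.1 ((e c).unop • (e b).unop • x)
    rw [map_mul, MulOpposite.unop_mul, mul_smul])
  smul_zero b := rfl
  smul_add b ψ φ := rfl
  add_smul b c ψ := Subtype.ext (AddMonoidHom.ext fun x => by
    change ψ.1 ((e (b + c)).unop • x) = ψ.1 ((e b).unop • x) + ψ.1 ((e c).unop • x)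
    rw [map_add, MulOpposite.unop_add, add_smul, map_add])
  zero_smul ψ := Subtype.ext (AddMonoidHom.ext fun x => by
    change ψ.1 ((e 0).unop • x) = 0
    rw [map_zero, MulOpposite.unop_zero, zero_smul, map_zero])

theorem twistedDual_smul_apply (X : Type u) [AddCommGroup X] [Module B' X] (b : B)
    (ψ : twistedDual e X) (x : X) : (b • ψ).1 x = ψ.1 ((e b).unop • x) := rfl

variable (e) in
theorem isDualPairing_twistedDual [FiniteDimensional K B'] [Module.Finite B' N] :
    IsDualPairing e (twistedDual e N).subtype := by
  let _ : Module K N := Module.compHom N (algebraMap K B')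
  have : IsScalarTower K B' N := ⟨fun k b m => by rw [Algebra.smul_def, mul_smul]; rfl⟩
  have : FiniteDimensional K N := Module.Finite.trans B' N
  have hsmul : ∀ (k : K) (ψ : twistedDual e N) (n : N),
      (algebraMap K B k • ψ).1 n = k * ψ.1 n := fun k ψ n => by
    rw [twistedDual_smul_apply, unop_algebraMap, ψ.2]
  let D : Module.Dual K N → twistedDual e N := fun φ =>
    ⟨φ.toAddMonoidHom, fun k x => φ.map_smul k x⟩
  refine ⟨hsmul, fun b ψ n => rfl, fun Ψ hΨ => ?_, fun ψ hψ => ⟨⟨ψ, hψ⟩, fun n => rfl⟩,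
    fun ψ hψ => Subtype.ext (AddMonoidHom.ext hψ), fun n hn => ?_⟩
  · let Φ : Module.Dual K (Module.Dual K N) := {
      toFun := fun φ => Ψ (D φ)
      map_add' := fun φ φ' => by
        rw [← map_add]
        rfl
      map_smul' := fun k φ => by
        rw [RingHom.id_apply, smul_eq_mul, ← hΨ]
        exact congrArg Ψ (Subtype.ext (AddMonoidHom.ext fun x => (hsmul k (D φ) x).symm)) }
    refine ⟨(Module.evalEquiv K N).symm Φ, fun ψ => ?_⟩
    let φ : Module.Dual K N := { ψ.1 with map_smul' := ψ.2 }
    have h1 : φ ((Module.evalEquiv K N).symm Φ) = Φ φ := Module.apply_evalEquiv_symm_apply K N φ Φ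
    exact h1
  · refine (Module.forall_dual_apply_eq_zero_iff K n).1 fun φ => hn (D φ)

variable (e) in
theorem exists_dual_left (N : Type u) [AddCommGroup N] [Module B' N] [FiniteDimensional K B']
    [Module.Finite B' N] : ∃ (M : ModuleCat.{u} B) (β : M →+ N →+ K),
      IsDualPairing e β ∧ Module.Finite B M :=
  ⟨.of B (twistedDual e N), _, isDualPairing_twistedDual e,
    (isDualPairing_twistedDual e).finite_left⟩

variable (e) in
theorem exists_dual_right (M : Type u) [AddCommGroup M] [Module B M] [FiniteDimensional K B]
    [Module.Finite B M] : ∃ (N : ModuleCat.{u} B') (β : M →+ N →+ K),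
      IsDualPairing e β ∧ Module.Finite B' N := by
  obtain ⟨N, β, h, hN⟩ := exists_dual_left (flipEquiv e) M
  refine ⟨N, β.flip, ?_, hN⟩
  have := h.flip
  rwa [flipEquiv_flipEquiv] at this

section Pairing

variable {β : M →+ N →+ K} {β' : M' →+ N' →+ K}

/-- Maps `X → N` correspond to maps from `M` to the dual of `X`. Restriction from the dual of `Y` to
that of `X` is onto, so projectivity of `M` provides the extension. `X` and `Y` may be
infinite-dimensional, hence the explicit `twistedDual`. -/
theorem IsDualPairing.injective_right (h : IsDualPairing e β) (hM : Module.Projective B M) :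
    Module.Injective B' N where
  out X Y _ _ _ _ f hf g := by
    let R : twistedDual e Y →ₗ[B] twistedDual e X := {
      toFun := fun ψ => ⟨ψ.1.comp f.toAddMonoidHom, fun k x => by
        change ψ.1 (f _) = k * ψ.1 (f x)
        rw [f.map_smul, ψ.2]⟩
      map_add' := fun ψ φ => rfl
      map_smul' := fun b ψ => Subtype.ext (AddMonoidHom.ext fun x => by
        change ψ.1 ((e b).unop • f x) = ψ.1 (f ((e b).unop • x))
        rw [f.map_smul]) }
    have hR : Function.Surjective R := fun ψ => by
      obtain ⟨φ, hφ, hφ'⟩ := exists_extension_of_injective hf ψ.1 ψ.2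
      exact ⟨⟨φ, hφ⟩, Subtype.ext (AddMonoidHom.ext hφ')⟩
    let Φ : M →ₗ[B] twistedDual e X := {
      toFun := fun m => ⟨(β m).comp g.toAddMonoidHom, fun k x => by
        change β m (g _) = k * β m (g x)
        rw [g.map_smul, h.smul_right]⟩
      map_add' := fun m m' => Subtype.ext (AddMonoidHom.ext fun x => by
        change β (m + m') (g x) = β m (g x) + β m' (g x)
        rw [map_add, AddMonoidHom.add_apply])
      map_smul' := fun b m => Subtype.ext (AddMonoidHom.ext fun x => by
        change β (b • m) (g x) = β m (g ((e b).unop • x))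
        rw [g.map_smul, h.adj]) }
    obtain ⟨Ψ, hΨ⟩ := Module.projective_lifting_property R Φ hR
    choose k hk using fun y : Y => h.left_surj
      (AddMonoidHom.mk' (fun m => (Ψ m).1 y) fun m m' => by rw [map_add]; rfl)
      fun c m => by
        change (Ψ _).1 y = c * (Ψ m).1 y
        rw [Ψ.map_smul, twistedDual_smul_apply, unop_algebraMap, (Ψ m).2]
    replace hk : ∀ y m, β m (k y) = (Ψ m).1 y := hk
    refine ⟨{
      toFun := k
      map_add' := fun x y => h.ext_right fun m => by simp [hk]
      map_smul' := fun b' y => h.ext_right fun m => by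
        rw [hk, RingHom.id_apply, h.adj', hk, Ψ.map_smul, twistedDual_smul_apply,
          e.apply_symm_apply, MulOpposite.unop_op] }, fun x => h.ext_right fun m => ?_⟩
    change β m (k (f x)) = _
    rw [hk]
    exact congrArg (fun ψ : twistedDual e X => ψ.1 x) (LinearMap.congr_fun hΨ m)

theorem IsDualPairing.injective_left (h : IsDualPairing e β) (hN : Module.Projective B' N) :
    Module.Injective B M := h.flip.injective_right hN

/-- A surjection from a free module dualizes to an embedding of the injective `M`, which splits; the
transpose of the retraction is a section of the surjection. -/
theorem IsDualPairing.projective_right [FiniteDimensional K B'] [Module.Finite B' N]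
    (h : IsDualPairing e β) (hM : Module.Injective B M) : Module.Projective B' N := by
  obtain ⟨n, q, hq⟩ := Module.Finite.exists_fin' B' N
  have hF := isDualPairing_twistedDual e (N := Fin n → B')
  obtain ⟨q', hq'⟩ := hF.flip.exists_transpose h.flip q
  obtain ⟨t, ht⟩ := Module.Injective.extend (h.flip.injective_transpose hq' hq)
    (LinearMap.id : M →ₗ[B] M)
  obtain ⟨t', ht'⟩ := hF.exists_transpose h t
  refine .of_split t' q (LinearMap.ext fun x => h.ext_right fun m => ?_)
  have h1 := hq' (t' x) m
  have h2 := ht' (q' m) x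
  have h3 : t (q' m) = m := LinearMap.congr_fun ht m
  rw [h3] at h2
  exact h1.symm.trans h2

theorem enoughFiniteInjectives_right (e : B ≃ₐ[K] B'ᵐᵒᵖ) [FiniteDimensional K B]
    [FiniteDimensional K B'] :
    EnoughFiniteInjectives B' := by
  intro N _ _ _
  obtain ⟨M, β, h, hM⟩ := exists_dual_left e N
  obtain ⟨n, q, hq⟩ := Module.Finite.exists_fin' B M
  obtain ⟨I, γ, hI, hIfin⟩ := exists_dual_right e (Fin n → B)
  obtain ⟨q', hq'⟩ := hI.exists_transpose h q
  exact ⟨I, q', hIfin, hI.injective_right inferInstance, h.injective_transpose hq' hq⟩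

theorem enoughFiniteInjectives_left (e : B ≃ₐ[K] B'ᵐᵒᵖ) [FiniteDimensional K B]
    [FiniteDimensional K B'] :
    EnoughFiniteInjectives B := enoughFiniteInjectives_right (flipEquiv e)

/-- A finitely generated injective module is a retract of a power of the dual of the regular
module. -/
theorem IsDualPairing.exists_retract_of_injective [FiniteDimensional K B] [FiniteDimensional K B']
    {D : Type u} [AddCommGroup D] [Module B' D] {γ : B →+ D →+ K} (hD : IsDualPairing e γ)
    [Module.Finite B' N] (hN : Module.Injective B' N) :
    ∃ (n : ℕ) (s : N →ₗ[B'] Fin n → D) (t : (Fin n → D) →ₗ[B'] N), t ∘ₗ s = LinearMap.id := by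
  obtain ⟨M, β, h, hM⟩ := exists_dual_left e N
  obtain ⟨n, q, hq⟩ := Module.Finite.exists_fin' B M
  obtain ⟨δ, hδ⟩ := hD.pi n
  obtain ⟨q', hq'⟩ := hδ.exists_transpose h q
  obtain ⟨t, ht⟩ := Module.Injective.extend (h.injective_transpose hq' hq)
    (LinearMap.id : N →ₗ[B'] N)
  exact ⟨n, q', t, ht⟩

theorem IsDualPairing.fpi_right [FiniteDimensional K B] [FiniteDimensional K B']
    (h : IsDualPairing e β) (hM : FPI B M) : FPI B' N := by
  have := hM.1
  have := h.finite_right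
  exact ⟨this, h.projective_right hM.2.2, h.injective_right hM.2.1⟩

end Pairing

/-- The dual of an injective coresolution by finite modules is a projective resolution. For the left
regular module this bounds the projective dimension of D(A). -/
theorem pdLT_of_idLT [FiniteDimensional K B] [FiniteDimensional K B'] {n : ℕ} :
    ∀ {M N : Type u} [AddCommGroup M] [Module B M] [AddCommGroup N] [Module B' N]
      [Module.Finite B M] {β : M →+ N →+ K}, IsDualPairing e β → IdLT B M (n + 1) →
      PdLT B' N (n + 1) := by
  induction n with
  | zero =>
    intro M N _ _ _ _ _ β h hM
    have := h.finite_right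
    exact pdLT_one.2 (h.projective_right (idLT_one.1 hM))
  | succ n ih =>
    intro M N _ _ _ _ _ β h hM
    obtain ⟨I, f, hI, hIinj, hf⟩ := enoughFiniteInjectives_left e M inferInstance
    have hSES := isSES_mkQ hf
    obtain ⟨I', γ, hγ, hI'⟩ := exists_dual_right e I
    obtain ⟨C', δ, hδ, -⟩ := exists_dual_right e (I ⧸ LinearMap.range f)
    obtain ⟨g', f', hSES'⟩ := hSES.exists_dual h hγ hδ
    exact hSES'.pdLT_right (hγ.projective_right hIinj) (ih hδ (hSES.idLT_right hIinj hM))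

theorem domGE_of_coGE [FiniteDimensional K B] [FiniteDimensional K B'] {n : ℕ} :
    ∀ {M N : Type u} [AddCommGroup M] [Module B M] [AddCommGroup N] [Module B' N]
      {β : M →+ N →+ K}, IsDualPairing e β → CoGE B n M → DomGE B' n N := by
  induction n with
  | zero => exact fun _ _ => .zero
  | succ n ih =>
    intro M N _ _ _ _ β h hM
    have : IsNoetherianRing B := IsNoetherianRing.of_finite K B
    obtain ⟨L, Q, f, g, h1, h2, h3⟩ := coGE_succ.1 hM
    have := h2.1
    have := h1.finite_left
    obtain ⟨Q', γ, hγ, -⟩ := exists_dual_right e Q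
    obtain ⟨L', δ, hδ, -⟩ := exists_dual_right e L
    obtain ⟨g', f', hSES⟩ := h1.exists_dual hδ hγ h
    exact domGE_succ.2 ⟨Q', L', g', f', hSES, hγ.fpi_right h2, ih hδ h3⟩

theorem coGE_of_domGE [FiniteDimensional K B] [FiniteDimensional K B'] {n : ℕ} :
    ∀ {M N : Type u} [AddCommGroup M] [Module B M] [AddCommGroup N] [Module B' N]
      {β : M →+ N →+ K}, IsDualPairing e β → DomGE B n M → CoGE B' n N := by
  induction n with
  | zero => exact fun _ _ => .zero
  | succ n ih =>
    intro M N _ _ _ _ β h hM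
    obtain ⟨Q, C, f, g, h1, h2, h3⟩ := domGE_succ.1 hM
    have := h2.1
    have := h1.finite_right
    obtain ⟨Q', γ, hγ, -⟩ := exists_dual_right e Q
    obtain ⟨C', δ, hδ, -⟩ := exists_dual_right e C
    obtain ⟨g', f', hSES⟩ := h1.exists_dual h hγ hδ
    exact coGE_succ.2 ⟨C', Q', g', f', hSES, hγ.fpi_right h2, ih hδ h3⟩

theorem IsDualPairing.coGE_iff_domGE [FiniteDimensional K B] [FiniteDimensional K B'] {n : ℕ}
    {β : M →+ N →+ K} (h : IsDualPairing e β) : CoGE B n M ↔ DomGE B' n N :=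
  ⟨domGE_of_coGE h, coGE_of_domGE h.flip⟩

end Duality
end AuslanderGorenstein

namespace AuslanderGorenstein

/-! ### The dual `KDual` as an instance of a perfect pairing. -/

section KDualPairing

variable {K : Type u} [Field K]

theorem IsDualPairing.of_equiv {B B' : Type u} [Ring B] [Ring B'] [Algebra K B] [Algebra K B']
    {e : B ≃ₐ[K] B'ᵐᵒᵖ} {M N : Type u} [AddCommGroup M] [Module B M] [Module K M]
    [IsScalarTower K B M] [FiniteDimensional K M] [AddCommGroup N] [Module B' N]
    (Λ : N ≃+ Module.Dual K M) (h : ∀ b m n, Λ n (b • m) = Λ ((e b).unop • n) m) :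
    ∃ β : M →+ N →+ K, IsDualPairing e β := by
  have hsmul : ∀ (k : K) (m : M) (φ : Module.Dual K M), φ (algebraMap K B k • m) = k * φ m :=
    fun k m φ => by rw [algebraMap_smul, map_smul, smul_eq_mul]
  have hΛ : ∀ k n, Λ (algebraMap K B' k • n) = k • Λ n := fun k n => LinearMap.ext fun m => by
    rw [← unop_algebraMap e, ← h, hsmul]
    rfl
  refine ⟨(AddMonoidHom.mk' (fun n => (Λ n).toAddMonoidHom) fun n n' => by
    rw [map_add]
    rfl).flip, fun k m n => hsmul k m (Λ n), h, fun ψ hψ => ?_, fun ψ hψ => ?_,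
    fun m hm => ?_, fun n hn => ?_⟩
  · let φ : Module.Dual K M :=
      { ψ with
        map_smul' := fun k m => (congrArg ψ (algebraMap_smul B k m).symm).trans (hψ k m) }
    refine ⟨Λ.symm φ, fun m => ?_⟩
    change Λ (Λ.symm φ) m = ψ m
    rw [Λ.apply_symm_apply]
    rfl
  · let Φ : Module.Dual K (Module.Dual K M) := {
      toFun := fun φ => ψ (Λ.symm φ)
      map_add' := fun φ φ' => by rw [map_add, map_add]
      map_smul' := fun k φ => by
        rw [RingHom.id_apply, smul_eq_mul, ← hψ]
        refine congrArg ψ (Λ.injective ?_)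
        rw [hΛ, Λ.apply_symm_apply, Λ.apply_symm_apply] }
    refine ⟨(Module.evalEquiv K M).symm Φ, fun n => ?_⟩
    refine (Module.apply_evalEquiv_symm_apply K M (Λ n) Φ).trans ?_
    exact congrArg ψ (Λ.symm_apply_apply n)
  · refine (Module.forall_dual_apply_eq_zero_iff K m).1 fun φ => ?_
    have : Λ (Λ.symm φ) m = 0 := hm (Λ.symm φ)
    rwa [Λ.apply_symm_apply] at this
  · exact Λ.injective ((LinearMap.ext hn).trans (map_zero Λ).symm)

variable (K) (A : Type u) [Ring A] [Algebra K A]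

/-- The identification of `Aᵐᵒᵖ` with the opposite of `A`. -/
abbrev opEquiv : Aᵐᵒᵖ ≃ₐ[K] Aᵐᵒᵖ := AlgEquiv.refl

theorem exists_isDualPairing_kDual (X : Type u) [AddCommGroup X] [Module K X] [Module Aᵐᵒᵖ X]
    [IsScalarTower K Aᵐᵒᵖ X] [SMulCommClass Aᵐᵒᵖ K X] [FiniteDimensional K X] :
    ∃ β : X →+ KDual K X →+ K, IsDualPairing (opEquiv K A) β :=
  IsDualPairing.of_equiv (AddEquiv.refl (Module.Dual K X)) fun _ _ _ => rfl

theorem exists_isDualPairing_regular [FiniteDimensional K A] :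
    ∃ β : A →+ KDual K A →+ K, IsDualPairing (flipEquiv (opEquiv K A)) β :=
  IsDualPairing.of_equiv (AddEquiv.refl (Module.Dual K A)) fun _ _ _ => rfl

/-- The regular right module. -/
def regularEquiv : A ≃ₗ[Aᵐᵒᵖ] Aᵐᵒᵖ where
  toFun := MulOpposite.op
  invFun := MulOpposite.unop
  map_add' _ _ := rfl
  map_smul' _ _ := rfl
  left_inv _ := rfl
  right_inv _ := rfl

end KDualPairing

/-! ### Auslander–Gorenstein algebras: dimensions and syzygies of D(A). -/

section Main

theorem Chain.split {B : Type u} [Ring B] {S : Type u} [AddCommGroup S] [Module B S] {m n : ℕ} :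
    ∀ {M : Type u} [AddCommGroup M] [Module B M], Chain B (m + n) M S →
      ∃ C : ModuleCat.{u} B, Chain B m M C ∧ Chain B n C S := by
  induction m with
  | zero =>
    intro M _ _ h
    rw [Nat.zero_add] at h
    exact ⟨.of B M, ⟨.refl B M⟩, h⟩
  | succ m ih =>
    intro M _ _ h
    rw [Nat.succ_add] at h
    obtain ⟨Q, C, f, g, h1, h2, h3⟩ := h
    obtain ⟨C', h4, h5⟩ := ih h3
    exact ⟨C', ⟨Q, C, f, g, h1, h2, h4⟩, h5⟩

theorem pdim_eq_iff {B : Type u} [Ring B] {M : Type u} [AddCommGroup M] [Module B M] {n : ℕ} :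
    pdim B M = (n : ℕ∞) ↔ PdLT B M (n + 1) ∧ ¬ PdLT B M n := by
  rw [← projectiveDimension_ge_iff]
  exact le_antisymm_iff.trans (and_congr_left fun _ => projectiveDimension_le_iff _ n)

theorem idim_eq_iff {B : Type u} [Ring B] {M : Type u} [AddCommGroup M] [Module B M] {n : ℕ} :
    idim B M = (n : ℕ∞) ↔ IdLT B M (n + 1) ∧ ¬ IdLT B M n := by
  rw [← injectiveDimension_ge_iff]
  exact le_antisymm_iff.trans (and_congr_left fun _ => injectiveDimension_le_iff _ n)

theorem isArtinianRing_op (K A : Type u) [Field K] [Ring A] [Algebra K A]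
    [FiniteDimensional K A] : IsArtinianRing Aᵐᵒᵖ := IsArtinianRing.of_finite K Aᵐᵒᵖ

instance finite_regular (A : Type u) [Ring A] : Module.Finite Aᵐᵒᵖ A :=
  .equiv (regularEquiv A).symm

theorem projective_regular (A : Type u) [Ring A] : Module.Projective Aᵐᵒᵖ A :=
  .of_equiv (regularEquiv A).symm

variable {K A : Type u} [Field K] [Ring A] [Algebra K A] [FiniteDimensional K A]

variable (K A) in
theorem finite_kDual : Module.Finite Aᵐᵒᵖ (KDual K A) := by
  obtain ⟨β, h⟩ := exists_isDualPairing_regular K A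
  exact h.finite_right

variable (K A) in
theorem injective_kDual : Module.Injective Aᵐᵒᵖ (KDual K A) := by
  obtain ⟨β, h⟩ := exists_isDualPairing_regular K A
  exact h.injective_right inferInstance

variable {r : ℕ} (hA : IsAuslanderGorenstein A r)
include K hA

variable (K) in
-- Dominant dimension r gives the chain, right injective dimension r makes its end `S` injective,
-- and left injective dimension r bounds the projective dimension of D(A), which puts D(A) in
-- add⁺(S).
theorem IsAuslanderGorenstein.exists_chain : ∃ S : ModuleCat.{u} Aᵐᵒᵖ, Chain Aᵐᵒᵖ r A S ∧
    Module.Finite Aᵐᵒᵖ S ∧ Module.Injective Aᵐᵒᵖ S ∧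
    ∃ n : ℕ, StableRetract Aᵐᵒᵖ (KDual K A) (Fin n → S) := by
  have := isArtinianRing_op K A
  obtain ⟨S, hS⟩ := ((domDim_eq_iff (enoughFiniteInjectives_left (opEquiv K A))).1 hA.domDim_eq).1
  have hid := (idim_eq_iff.1 hA.idim_right).1
  obtain ⟨β, h⟩ := exists_isDualPairing_regular K A
  have := finite_kDual K A
  refine ⟨S, hS, hS.finite, hS.injective hid, ?_⟩
  exact exists_stableRetract_of_injective (hS.congr_left (regularEquiv A).symm)
    (hid.congr (regularEquiv A)) (injective_kDual K A)
    (pdLT_of_idLT h (idim_eq_iff.1 hA.idim_left).1)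

theorem IsAuslanderGorenstein.domGE (P : Type u) [AddCommGroup P] [Module Aᵐᵒᵖ P]
    (_ : Module.Finite Aᵐᵒᵖ P) (_ : Module.Projective Aᵐᵒᵖ P) : DomGE Aᵐᵒᵖ r P := by
  obtain ⟨S, hS, -⟩ := hA.exists_chain K
  obtain ⟨n, s, t, -, -, hst⟩ := Module.Finite.exists_comp_eq_id_of_projective Aᵐᵒᵖ P
  exact ((hS.congr_left (regularEquiv A).symm).domGE.pi n).of_stableRetract (.of_retract t s hst)

/-- The end `S` of the chain has codominant dimension at least r; this passes to D(A) in add⁺(S),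
and then to all finitely generated injectives, which lie in add(D(A)). -/
theorem IsAuslanderGorenstein.coGE (J : Type u) [AddCommGroup J] [Module Aᵐᵒᵖ J]
    (_ : Module.Finite Aᵐᵒᵖ J) (hJ : Module.Injective Aᵐᵒᵖ J) : CoGE Aᵐᵒᵖ r J := by
  obtain ⟨S, hS, -, -, n, hn⟩ := hA.exists_chain K
  obtain ⟨β, h⟩ := exists_isDualPairing_regular K A
  obtain ⟨m, s, t, hst⟩ := h.exists_retract_of_injective hJ
  exact ((hS.coChain.coGE).pi n |>.of_stableRetract hn).pi m |>.of_stableRetract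
    (.of_retract s t hst)

theorem IsAuslanderGorenstein.domGE_of_pdLT {X : Type u} [AddCommGroup X] [Module Aᵐᵒᵖ X]
    [Module.Finite Aᵐᵒᵖ X] {i : ℕ} (h : PdLT Aᵐᵒᵖ X (i + 1)) : DomGE Aᵐᵒᵖ (r - i) X := by
  have := isArtinianRing_op K A
  exact AuslanderGorenstein.domGE_of_pdLT (fun P _ _ h1 h2 => hA.domGE (K := K) P h1 h2) h

/-- Dualize to left modules. The left projectives are the duals of right injectives, so their
dominant dimension is at least r by the previous results; no assumption on the left dominant
dimension is needed. -/
theorem IsAuslanderGorenstein.coGE_of_idLT {X : Type u} [AddCommGroup X] [Module Aᵐᵒᵖ X]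
    [Module.Finite Aᵐᵒᵖ X] {j : ℕ} (h : IdLT Aᵐᵒᵖ X (j + 1)) : CoGE Aᵐᵒᵖ (r - j) X := by
  have : IsArtinianRing A := IsArtinianRing.of_finite K A
  obtain ⟨Y, β, hβ, hY⟩ := exists_dual_right (opEquiv K A) X
  refine hβ.coGE_iff_domGE.2 (AuslanderGorenstein.domGE_of_pdLT (fun P _ _ _ _ => ?_)
    (pdLT_of_idLT hβ h))
  obtain ⟨J, γ, hγ, hJ⟩ := exists_dual_left (opEquiv K A) P
  exact hγ.coGE_iff_domGE.1 (hA.coGE (K := K) J hJ (hγ.injective_left inferInstance))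

theorem IsAuslanderGorenstein.chain_of_isSyzygy {i : ℕ} {S : Type u}
    [AddCommGroup S] [Module Aᵐᵒᵖ S] (hS : IsSyzygy Aᵐᵒᵖ (r - i) (KDual K A) S) :
    Chain Aᵐᵒᵖ (r - i) S (KDual K A) :=
  (AuslanderGorenstein.chain_of_isSyzygy (CoGE.mono (Nat.sub_le r i)
    (hA.coGE (K := K) _ (finite_kDual K A) (injective_kDual K A))) hS).chain

/-- The modules `Ω^{r-i}(D(A))` and `Ω^{-i}(A)` generate the same subcategory. -/
theorem IsAuslanderGorenstein.stableRetract_syzygy {i : ℕ} (hi : i ≤ r) {S S' : Type u}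
    [AddCommGroup S] [Module Aᵐᵒᵖ S] [AddCommGroup S'] [Module Aᵐᵒᵖ S']
    (hS : IsSyzygy Aᵐᵒᵖ (r - i) (KDual K A) S) (hS' : IsCosyzygy Aᵐᵒᵖ i A S') :
    (∃ n : ℕ, StableRetract Aᵐᵒᵖ S (Fin n → S')) ∧ ∃ n : ℕ, StableRetract Aᵐᵒᵖ S' (Fin n → S) := by
  obtain ⟨I, hI, hIfin, hIinj, n, hn⟩ := hA.exists_chain K
  obtain ⟨β, h⟩ := exists_isDualPairing_regular K A
  have hS1 := hA.chain_of_isSyzygy hS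
  have hS2 : Chain Aᵐᵒᵖ i A S' := chain_of_isCosyzygy (hI.domGE.mono hi) hS'
  -- Cut the chain from A to `I` at place `i`. The intermediate module `C` is stably the cosyzygy
  -- `S'` by its left half, and generates the same add⁺ as the syzygy `S` by its right half, because
  -- `I` and D(A) do.
  rw [← Nat.add_sub_cancel' hi] at hI
  obtain ⟨C, hC1, hC2⟩ := hI.split
  obtain ⟨m, s, t, hst⟩ := h.exists_retract_of_injective hIinj
  have h1 : StableRetract Aᵐᵒᵖ S (Fin n → C) := (hS1.stableRetract (hC2.pi n)).2 hn
  have h2 : StableRetract Aᵐᵒᵖ C (Fin m → S) :=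
    (hC2.stableRetract (hS1.pi m)).2 (.of_retract s t hst)
  have h3 : StableRetract Aᵐᵒᵖ C S' := (hC1.stableRetract hS2).1 .refl
  have h4 : StableRetract Aᵐᵒᵖ S' C := (hS2.stableRetract hC1).1 .refl
  exact ⟨⟨n, h1.trans (h3.pi n)⟩, m, h4.trans h2⟩

/-- Modules in `add⁺(Ω^{r-i}(D(A)))` have projective dimension at most `i` and injective
dimension at most `r - i`. -/
theorem IsAuslanderGorenstein.dims_le {i : ℕ} (hi : i ≤ r) {S X : Type u}
    [AddCommGroup S] [Module Aᵐᵒᵖ S] [AddCommGroup X] [Module Aᵐᵒᵖ X]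
    (hS : IsSyzygy Aᵐᵒᵖ (r - i) (KDual K A) S) {n : ℕ} (hX : StableRetract Aᵐᵒᵖ X (Fin n → S)) :
    PdLT Aᵐᵒᵖ X (i + 1) ∧ IdLT Aᵐᵒᵖ X (r - i + 1) := by
  have := isArtinianRing_op K A
  have := injective_kDual K A
  have := projective_regular A
  have hS1 := hA.chain_of_isSyzygy hS
  obtain ⟨S', hS'⟩ := (enoughFiniteInjectives_left (opEquiv K A)).exists_isCosyzygy i A
  -- The chain from `S` to D(A) shows only the injective dimension; the projective one is read off
  -- from the chain from A to the cosyzygy `S'`.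
  obtain ⟨⟨m, hm⟩, -⟩ := hA.stableRetract_syzygy hi hS hS'
  have hS2 : Chain Aᵐᵒᵖ i A S' := chain_of_isCosyzygy
    ((hA.domGE (K := K) A inferInstance inferInstance).mono hi) hS'
  refine ⟨(hX.trans_pi hm).pdLT ?_, hX.idLT ?_⟩
  · exact (hS2.pi (n * m)).coChain.pdLT (.finPi _)
  · exact (hS1.pi n).idLT (.finPi _)

/-- The two upper bounds already give the lower bounds on dominant and codominant dimension. Any
deviation in one of the four numbers makes dominant exceed injective dimension, or codominant exceed
projective dimension, or the module zero, and each makes `X` projective-injective. -/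
theorem IsAuslanderGorenstein.hasDims {i : ℕ} (hi : i ≤ r) {X : Type u}
    [AddCommGroup X] [Module K X] [Module Aᵐᵒᵖ X] [IsScalarTower K Aᵐᵒᵖ X]
    [FiniteDimensional K X] (hpd : PdLT Aᵐᵒᵖ X (i + 1)) (hid : IdLT Aᵐᵒᵖ X (r - i + 1))
    (hX : ¬ IsProjInj Aᵐᵒᵖ X) : HasDims K A X i (r - i) := by
  have := isArtinianRing_op K A
  have : IsArtinianRing A := IsArtinianRing.of_finite K A
  have : Module.Finite Aᵐᵒᵖ X := Module.Finite.of_restrictScalars_finite K Aᵐᵒᵖ X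
  obtain ⟨β, h⟩ := exists_isDualPairing_kDual K A X
  have := h.finite_right
  have hdom : ¬ DomGE Aᵐᵒᵖ (r - i + 1) X := fun hd => hX (isProjInj_of_idLT hid hd)
  have hcodom : ¬ CoGE Aᵐᵒᵖ (i + 1) X := fun hd => hX (isProjInj_of_pdLT hpd hd)
  refine ⟨pdim_eq_iff.2 ⟨hpd, fun hlt => ?_⟩, idim_eq_iff.2 ⟨hid, fun hlt => ?_⟩,
    (domDim_eq_iff (enoughFiniteInjectives_left (opEquiv K A))).2
      ⟨hA.domGE_of_pdLT (K := K) hpd, hdom⟩,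
    (domDim_eq_iff (enoughFiniteInjectives_right (opEquiv K A))).2 ?_⟩
  · obtain _ | i := i
    · have := ModuleCat.subsingleton_of_isZero 
        ((hasProjectiveDimensionLT_zero_iff_isZero _).1 hlt)
      exact hX .of_subsingleton
    -- Projective dimension below `i + 1` would raise the dominant dimension to `r - i`, one more
    -- than the injective dimension allows.
    · refine hdom ?_
      have := hA.domGE_of_pdLT (K := K) hlt
      rwa [show r - (i + 1) + 1 = r - i by lia]
  · rcases hj : r - i with _ | j
    · rw [hj] at hlt
      have := ModuleCat.subsingleton_of_isZero 
        ((hasInjectiveDimensionLT_zero_iff_isZero _).1 hlt)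
      exact hX .of_subsingleton
    · rw [hj] at hlt
      have := hA.coGE_of_idLT (K := K) hlt
      rw [show r - j = i + 1 by lia] at this
      exact hcodom this
  · rw [← h.coGE_iff_domGE, ← h.coGE_iff_domGE]
    refine ⟨?_, hcodom⟩
    have := hA.coGE_of_idLT (K := K) hid
    rwa [Nat.sub_sub_self hi] at this

end Main
end AuslanderGorenstein

namespace AuslanderGorenstein

/-! ### Membership in add⁺ of the syzygies and cosyzygies. -/

section Categories

theorem NoProjInjSummand.of_inAdd {B : Type u} [Ring B] {S M : Type u} [AddCommGroup S]
    [Module B S] [AddCommGroup M] [Module B M] (h : InAdd B S M)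
    (hS : ∀ (N : Type u) [AddCommGroup N] [Module B N], IsProjInj B N → InAdd B S N →
      Subsingleton N) : NoProjInjSummand B M := fun U _ hUV hU =>
  (Submodule.subsingleton_iff_eq_bot).1 (hS U hU (h.of_isCompl hUV))

variable {K A : Type u} [Field K] [Ring A] [Algebra K A] [FiniteDimensional K A]
variable (K A) in
theorem exists_isSyzygy_isCosyzygy (m n : ℕ) : ∃ S S' : ModuleCat.{u} Aᵐᵒᵖ,
    IsSyzygy Aᵐᵒᵖ m (KDual K A) S ∧ IsCosyzygy Aᵐᵒᵖ n A S' := by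
  have := isArtinianRing_op K A
  have := finite_kDual K A
  obtain ⟨S, hS⟩ := exists_isSyzygy (B := Aᵐᵒᵖ) m (KDual K A)
  obtain ⟨S', hS'⟩ := (enoughFiniteInjectives_left (opEquiv K A)).exists_isCosyzygy n A
  exact ⟨S, S', hS, hS'⟩

variable {r : ℕ} (hA : IsAuslanderGorenstein A r)
include K hA

/-- A module of projective dimension at most `i` and injective dimension at most `r - i` lies in
`add⁺(Ω^{r-i}(D(A)))`. -/
theorem IsAuslanderGorenstein.stableRetract_of_dims {i : ℕ} {X S : Type u}
    [AddCommGroup X] [Module Aᵐᵒᵖ X] [Module.Finite Aᵐᵒᵖ X] [AddCommGroup S] [Module Aᵐᵒᵖ S]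
    (hpd : PdLT Aᵐᵒᵖ X (i + 1)) (hid : IdLT Aᵐᵒᵖ X (r - i + 1))
    (hS : IsSyzygy Aᵐᵒᵖ (r - i) (KDual K A) S) : ∃ n : ℕ, StableRetract Aᵐᵒᵖ X (Fin n → S) := by
  obtain ⟨J, hJ⟩ := hA.domGE_of_pdLT (K := K) hpd
  have := hJ.finite
  obtain ⟨β, h⟩ := exists_isDualPairing_regular K A
  -- The chain from `X` has length `r - i`, exactly the bound on the injective dimension, so its end
  -- `J` is injective and hence in add(D(A)).
  obtain ⟨m, s, t, hst⟩ := h.exists_retract_of_injective (hJ.injective hid)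
  exact ⟨m, (hJ.stableRetract ((hA.chain_of_isSyzygy hS).pi m)).2 (.of_retract s t hst)⟩

theorem IsAuslanderGorenstein.inAddPI_iff {i : ℕ} (hi : i ≤ r) {S S' X : Type u}
    [AddCommGroup S] [Module Aᵐᵒᵖ S] [AddCommGroup S'] [Module Aᵐᵒᵖ S']
    [AddCommGroup X] [Module Aᵐᵒᵖ X]
    (hS : IsSyzygy Aᵐᵒᵖ (r - i) (KDual K A) S) (hS' : IsCosyzygy Aᵐᵒᵖ i A S') :
    InAddPI Aᵐᵒᵖ S X ↔ InAddPI Aᵐᵒᵖ S' X := by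
  obtain ⟨⟨m, hm⟩, n, hn⟩ := hA.stableRetract_syzygy hi hS hS'
  rw [AuslanderGorenstein.inAddPI_iff, AuslanderGorenstein.inAddPI_iff]
  exact ⟨fun ⟨k, hk⟩ => ⟨_, hk.trans_pi hm⟩, fun ⟨k, hk⟩ => ⟨_, hk.trans_pi hn⟩⟩

end Categories
end AuslanderGorenstein

/-! ### The theorem. -/

open AuslanderGorenstein in
theorem mainTheorem7 {K A : Type u} [Field K] [Ring A] [Algebra K A] [FiniteDimensional K A]
    (r : ℕ) (hA : IsAuslanderGorenstein A r) (i : ℕ) (hi : i ≤ r)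
    (X : Type u) [AddCommGroup X] [Module K X] [Module Aᵐᵒᵖ X] [IsScalarTower K Aᵐᵒᵖ X]
    [FiniteDimensional K X] :
    -- modules with these two dimensions
    (pdim Aᵐᵒᵖ X = (i : ℕ∞) → idim Aᵐᵒᵖ X = ((r - i : ℕ) : ℕ∞) →
      domDim Aᵐᵒᵖ X = ((r - i : ℕ) : ℕ∞) ∧ codomDim K A X = (i : ℕ∞) ∧
      InAddPISyzygy Aᵐᵒᵖ (r - i) (KDual K A) X ∧
      InAddPICosyzygy Aᵐᵒᵖ i A X ∧
      (NoProjInjSummand Aᵐᵒᵖ X →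
        InAddSyzygy Aᵐᵒᵖ (r - i) (KDual K A) X ∧ InAddCosyzygy Aᵐᵒᵖ i A X)) ∧
    -- equality of the two subcategories
    (InAddPISyzygy Aᵐᵒᵖ (r - i) (KDual K A) X ↔ InAddPICosyzygy Aᵐᵒᵖ i A X) ∧
    (0 < i → i < r →
      (InAddSyzygy Aᵐᵒᵖ (r - i) (KDual K A) X ↔ InAddCosyzygy Aᵐᵒᵖ i A X)) ∧
    -- the converse
    (InAddPISyzygy Aᵐᵒᵖ (r - i) (KDual K A) X → ¬ IsProjInj Aᵐᵒᵖ X →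
      HasDims K A X i (r - i)) ∧
    (0 < i → i < r → InAddSyzygy Aᵐᵒᵖ (r - i) (KDual K A) X → Nontrivial X →
      HasDims K A X i (r - i)) := by
  have := isArtinianRing_op K A
  have hfin : Module.Finite Aᵐᵒᵖ X := Module.Finite.of_restrictScalars_finite K Aᵐᵒᵖ X
  obtain ⟨S, S', hS, hS'⟩ := exists_isSyzygy_isCosyzygy K A (r - i) i
  have hconv : InAddPISyzygy Aᵐᵒᵖ (r - i) (KDual K A) X → ¬ IsProjInj Aᵐᵒᵖ X →
      HasDims K A X i (r - i) := by
    rintro ⟨T, _, _, hT, hTX⟩ hX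
    obtain ⟨n, hn⟩ := inAddPI_iff.1 hTX
    obtain ⟨hpd, hid⟩ := hA.dims_le hi hT hn
    exact hA.hasDims (K := K) hi hpd hid hX
  have hadd : ∀ {T : Type u} [AddCommGroup T] [Module Aᵐᵒᵖ T], InAddPI Aᵐᵒᵖ T X →
      NoProjInjSummand Aᵐᵒᵖ X → InAdd Aᵐᵒᵖ T X := fun h hX =>
    (inAddPI_iff.1 h).elim fun _ hn => InAdd.of_stableRetract hn hX
  refine ⟨fun hpd hid => ?_, ⟨?_, ?_⟩, fun h0 hr => ⟨?_, ?_⟩, hconv, ?_⟩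
  · rw [pdim_eq_iff] at hpd
    rw [idim_eq_iff] at hid
    -- Since `r > 0`, one of `i` and `r - i` is positive, so `X` is not both projective and
    -- injective.
    have hX : ¬ IsProjInj Aᵐᵒᵖ X := by
      rintro ⟨h1, h2⟩
      have hr := hA.two_le
      obtain rfl | h0 := Nat.eq_zero_or_pos i
      · exact hid.2 ((idLT_one.2 h2).mono (by lia))
      · exact hpd.2 ((pdLT_one.2 h1).mono h0)
    have hdims := hA.hasDims (K := K) hi hpd.1 hid.1 hX
    have h1 : InAddPI Aᵐᵒᵖ S X :=
      inAddPI_iff.2 (hA.stableRetract_of_dims hpd.1 hid.1 hS)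
    have h2 : InAddPI Aᵐᵒᵖ S' X := (hA.inAddPI_iff hi hS hS').1 h1
    exact ⟨hdims.domDim_eq, hdims.codomDim_eq, ⟨S, _, _, hS, h1⟩, ⟨S', _, _, hS', h2⟩,
      fun hno => ⟨⟨S, _, _, hS, hadd h1 hno⟩, ⟨S', _, _, hS', hadd h2 hno⟩⟩⟩
  · rintro ⟨T, _, _, hT, hTX⟩
    exact ⟨S', _, _, hS', (hA.inAddPI_iff hi hT hS').1 hTX⟩
  · rintro ⟨T, _, _, hT, hTX⟩
    exact ⟨S, _, _, hS, (hA.inAddPI_iff hi hS hT).2 hTX⟩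
  · rintro ⟨T, _, _, hT, hTX⟩
    refine ⟨S', _, _, hS', hadd ((hA.inAddPI_iff hi hT hS').1 hTX.inAddPI)
      (.of_inAdd hTX fun N _ _ hN hTN => ?_)⟩
    -- Here `i < r` enters: the syzygy has positive index, so its add contains no nonzero injective
    -- module.
    rw [show r - i = r - i - 1 + 1 by lia] at hT
    exact subsingleton_of_inAdd_syzygy hN.2 hTN hT
  · rintro ⟨T, _, _, hT, hTX⟩
    refine ⟨S, _, _, hS, hadd ((hA.inAddPI_iff hi hS hT).2 hTX.inAddPI)
      (.of_inAdd hTX fun N _ _ hN hTN => ?_)⟩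
    -- Here `0 < i` enters: the cosyzygy has positive index, so its add contains no nonzero
    -- projective module.
    rw [show i = i - 1 + 1 by lia] at hT
    exact subsingleton_of_inAdd_cosyzygy hN.1 hTN hT
  · rintro h0 hr ⟨T, _, _, hT, hTX⟩ hX
    refine hconv ⟨T, _, _, hT, hTX.inAddPI⟩ fun hPI => ?_
    rw [show r - i = r - i - 1 + 1 by lia] at hT
    exact not_subsingleton X (subsingleton_of_inAdd_syzygy hPI.2 hTX hT)
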